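/- Let $\mathbb S^2\subset\mathbb R^3$ be the unit sphere with coordinates $x=(x_1,x_2,x_3)$, let $d\omega$ be its surface measure normalized so that $\int_{\mathbb S^2}d\omega=1$, and let $H^1(\mathbb S^2)$ be the Sobolev space obtained by completing $C^\infty(\mathbb S^2)$ in the norm $(\int|u|^2d\omega+\int|\nabla u|^2d\omega)^{1/2}$. For real $\alpha$ and $u\in H^1(\mathbb S^2)$ put $$I_\alpha(u)=\alpha\int_{\mathbb S^2}|\nabla u|^2d\omega+2\int_{\mathbb S^2}u\,d\omega-\frac12\log\Big[\Big(\int_{\mathbb S^2}e^{2u}d\omega\Big)^2-\sum_{i=1}^3\Big(\int_{\mathbb S^2}e^{2u}x_i\,d\omega\Big)^2\Big],$$ and let $D^2I_\alpha(0)(\phi,\phi)=\frac{d^2}{dt^2}\big|_{t=0}I_\alpha(t\phi)$ be the second variation of $I_\alpha$ at $u\equiv0$ in the direction $\phi\in H^1(\mathbb S^2)$. Let $\mathcal H=\{u\in H^1(\mathbb S^2):\int_{\mathbb S^2} e^{2u}d\omega=1\}$. Then $I_\alpha$ is well defined on $H^1(\mathbb S^2)$ ($e^{2u}$ is integrable and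 the argument of the logarithm is positive for every $u\in H^1(\mathbb S^2)$), for every $\phi\in H^1(\mathbb S^2)$ the function $t\mapsto I_\alpha(t\phi)$ is $C^2$ near $t=0$, and the following hold. i) If $\alpha\in(\frac23,1)$, then $D^2I_\alpha(0)(\phi,\phi)\ge0$ for all $\phi\in H^1(\mathbb S^2)$, with equality if and only if $\phi$ is (a.e. equal to) a constant. In particular $D^2I_\alpha(0)$ is positive definite when restricted to $\mathcal H$: $D^2I_\alpha(0)(\phi,\phi)>0$ for every nonzero $\phi\in\mathcal H$, and also for every nonzero $\phi$ in the tangent space $\{\phi\in H^1(\mathbb S^2):\int_{\mathbb S^2}\phi\,d\omega=0\}$ of $\mathcal H$ at $0$. ii) If $\alpha=\frac23$, then $D^2I_\alpha(0)(\phi,\phi)\ge0$ for all $\phi\in H^1(\mathbb S^2)$, with equality if and only if $\phi$ is (a.e. equal to) a linear combination of $1,x_1,x_2,x_3$. iii) If $\alpha<\frac23$, then $D^2I_\alpha(0)$ is not non-negative: $D^2I_\alpha(0)(\phi,\phi)<0$ for some $\phi\in H^1(\mathbb S^2)$. In particular $I_\alpha(u)<0$ for some $u\in H^1(\mathbb S^2)$.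 -/

import Mathlib

open MeasureTheory Metric
open scoped ContDiff

noncomputable section

/-- Euclidean three-space `ℝ³`. -/
abbrev E3 : Type := EuclideanSpace ℝ (Fin 3)

/-- The unit sphere `𝕊²` of `ℝ³`. -/
abbrev S2 : Type := sphere (0 : E3) 1

/-- The surface measure `dω` of `𝕊²`, normalized to total mass one. -/
def dω : Measure S2 :=
  ((volume : Measure E3).toSphere Set.univ)⁻¹ • (volume : Measure E3).toSphere

/-- The gradient on `𝕊²` of (the restriction to `𝕊²` of) a smooth function `f` on `ℝ³`:
the tangential part of the Euclidean gradient. Every smooth function on `𝕊²` is such a restriction,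
and the tangential part depends on the restriction only. -/
def sphGrad (f : E3 → ℝ) (x : S2) : E3 :=
  gradient f x - (inner ℝ (gradient f x) (x : E3)) • (x : E3)

/-- The pairs `(f, ∇f)` in `L²(𝕊²; ℝ) × L²(𝕊²; ℝ³)`, for `f` a smooth function on `𝕊²`. -/
def smoothGraph : Submodule ℝ (Lp ℝ 2 dω × Lp E3 2 dω) where
  carrier := {p | ∃ f : E3 → ℝ, ContDiff ℝ ∞ f ∧
    (p.1 : S2 → ℝ) =ᵐ[dω] (fun x => f x) ∧ (p.2 : S2 → E3) =ᵐ[dω] sphGrad f}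
  zero_mem' := by
    refine ⟨fun _ => 0, contDiff_const, ?_, ?_⟩
    · filter_upwards [Lp.coeFn_zero ℝ 2 dω] with x hx
      simpa using hx
    · filter_upwards [Lp.coeFn_zero E3 2 dω] with x hx
      simpa [sphGrad, gradient_const] using hx
  add_mem' := by
    rintro p q ⟨f, hf, hf1, hf2⟩ ⟨g, hg, hg1, hg2⟩
    refine ⟨fun x => f x + g x, hf.add hg, ?_, ?_⟩
    · filter_upwards [Lp.coeFn_add p.1 q.1, hf1, hg1] with x h h1 h2
      simpa [h1, h2] using h
    · filter_upwards [Lp.coeFn_add p.2 q.2, hf2, hg2] with x h h1 h2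
      have hg' : gradient (fun y => f y + g y) (x : E3) = gradient f x + gradient g x := by
        have := ((hf.differentiable (by simp) (x : E3)).hasGradientAt).hasFDerivAt.add
          ((hg.differentiable (by simp) (x : E3)).hasGradientAt).hasFDerivAt
        refine HasGradientAt.gradient ?_
        rw [hasGradientAt_iff_hasFDerivAt, map_add]
        exact this
      rw [Prod.snd_add, h, Pi.add_apply, h1, h2]
      simp only [sphGrad, hg', inner_add_left, add_smul]
      abel
  smul_mem' := by
    rintro c p ⟨f, hf, hf1, hf2⟩
    refine ⟨fun x => c * f x, contDiff_const.mul hf, ?_, ?_⟩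
    · filter_upwards [Lp.coeFn_smul c p.1, hf1] with x h h1
      simpa [h1] using h
    · filter_upwards [Lp.coeFn_smul c p.2, hf2] with x h h1
      have hg' : gradient (fun y => c * f y) (x : E3) = c • gradient f x := by
        have := ((hf.differentiable (by simp) (x : E3)).hasGradientAt).hasFDerivAt.const_mul c
        refine HasGradientAt.gradient ?_
        rw [hasGradientAt_iff_hasFDerivAt]
        simpa using this
      rw [Prod.smul_snd, h, Pi.smul_apply, h1]
      simp only [sphGrad, hg', inner_smul_left, smul_sub, smul_smul]
      simp

/-- The Sobolev space `H¹(𝕊²)`: the completion of the smooth functions for the norm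
`(∫ |u|² + ∫ |∇u|²)^(1/2)`, realized as the closure of the graph of the gradient in
`L²(𝕊²; ℝ) × L²(𝕊²; ℝ³)`. An element `u` consists of a function `u.1` and its gradient `u.2`. -/
abbrev H1 : Type := smoothGraph.topologicalClosure

/-- The function on `𝕊²` (defined up to null sets) underlying an element of `H¹(𝕊²)`. -/
def H1.val (u : H1) : S2 → ℝ := (u : Lp ℝ 2 dω × Lp E3 2 dω).1

/-- The gradient of an element of `H¹(𝕊²)`. -/
def H1.grad (u : H1) : S2 → E3 := (u : Lp ℝ 2 dω × Lp E3 2 dω).2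

/-- `(∫ e^{2u} dω)² - ∑ᵢ (∫ e^{2u} xᵢ dω)²`. -/
def expDet (u : H1) : ℝ :=
  (∫ x, Real.exp (2 * u.val x) ∂dω) ^ 2
    - ∑ i : Fin 3, (∫ x, Real.exp (2 * u.val x) * (x : E3) i ∂dω) ^ 2

/-- The functional `I_α` on `H¹(𝕊²)`. -/
def functionalI (α : ℝ) (u : H1) : ℝ :=
  α * (∫ x, ‖u.grad x‖ ^ 2 ∂dω) + 2 * (∫ x, u.val x ∂dω) - 1 / 2 * Real.log (expDet u)

/-- The second variation `D²J(u)(φ, φ)`: the second derivative of `t ↦ J(u + tφ)` at `t = 0`. -/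
def secondVariation (J : H1 → ℝ) (u φ : H1) : ℝ :=
  iteratedDeriv 2 (fun t : ℝ => J (u + t • φ)) 0

/-- The normalized class `ℋ = {u ∈ H¹(𝕊²) : ∫ e^{2u} dω = 1}`. -/
def normalizedClass : Set H1 :=
  {u | Integrable (fun x => Real.exp (2 * u.val x)) dω ∧ ∫ x, Real.exp (2 * u.val x) ∂dω = 1}

end

/-!
The second variation of `I_α` at `0` in the direction `φ` is
`2 α ∫ |∇φ|² - 4 (∫ φ² - (∫ φ)²) + 4 ∑ᵢ (∫ φ xᵢ)²` (`secondVariation_eq`). Write `φ` as the sum of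
its orthogonal projection to the span of `1, x₁, x₂, x₃` and a remainder `ψ`. As `xᵢ` is an
eigenfunction of the spherical Laplacian with eigenvalue `2` and `∫ xᵢ² = 1 / 3`, the form becomes
`2 α ∫ |∇ψ|² - 4 ∫ ψ² + (12 α - 8) ∑ᵢ (∫ φ xᵢ)²` (`secondVariation_eq_remainder`). The next
eigenvalue of the spherical Laplacian is `6`, so `∫ |∇ψ|² ≥ 6 ∫ ψ²` (`H1.spectral_gap`), and all
claims on the sign can be read off.

The spectral gap is proved without elliptic theory. The three rotation fields preserve the surface
measure and span the tangent planes isometrically, so integration by parts along them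
(`integral_fderiv_skew`) gives Green's formula between `H¹` functions and polynomials, with
`-∑ₖ (rotD k)²` as the spherical Laplacian. On polynomials this operator is symmetric and
triangular with respect to the degree, with diagonal entries `N (N + 1)`, which gives the inequality
for polynomials; projecting an `H¹` function to the polynomials of degree at most `N` decreases its
Dirichlet energy, and polynomials are dense in `L²`. The same integration by parts shows that the
gradient is closable (`H1.eq_zero_of_val`): an element of `H¹` is determined by its function.

That `I_α` is defined and smooth along lines requires `e^{cu}` to be integrable for all `u ∈ H¹`
(`H1.integrable_exp`). The Sobolev inequality `‖f‖_{L²} ≤ K (‖f‖_{L¹} + ‖∇f‖_{L¹})` on the sphere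
(`exists_sobolev`) is obtained on each face of the circumscribed cube by bounding `|f|²` by the
product of a function of the first and one of the second coordinate. Applied to powers of `f`,
it gives `∫ f^{2k} ≤ (C E)^k (k!)²` with `E` the square of the `H¹` norm, hence a bound for
`∫ cosh (c f)` for small `c² E`, which passes to `H¹` by Fatou's lemma; the smallness is removed by
approximation with smooth, hence bounded, functions.
-/

/-! ### The normalized surface measure and its invariance -/

theorem finrank_E3 : Module.finrank ℝ E3 = 3 := by simp

instance : IsProbabilityMeasure dω := by
  refine ⟨?_⟩
  rw [dω, Measure.smul_apply, smul_eq_mul]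
  refine ENNReal.inv_mul_cancel ?_ (measure_ne_top _ _)
  rw [Measure.measure_univ_ne_zero]
  exact Measure.toSphere_ne_zero _

/-- The restriction to the sphere of a linear isometry of `ℝ³`. -/
noncomputable def sphMap (R : E3 ≃ₗᵢ[ℝ] E3) (x : S2) : S2 :=
  ⟨R x, by rw [mem_sphere_zero_iff_norm, R.norm_map]; exact norm_eq_of_mem_sphere x⟩

@[simp] theorem coe_sphMap (R : E3 ≃ₗᵢ[ℝ] E3) (x : S2) : (sphMap R x : E3) = R x := rfl

theorem continuous_sphMap (R : E3 ≃ₗᵢ[ℝ] E3) : Continuous (sphMap R) := by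
  unfold sphMap
  fun_prop

open scoped Pointwise in
theorem measurePreserving_sphMap_toSphere (R : E3 ≃ₗᵢ[ℝ] E3) :
    MeasurePreserving (sphMap R) (volume : Measure E3).toSphere (volume : Measure E3).toSphere := by
  refine ⟨(continuous_sphMap R).measurable, ?_⟩
  ext s hs
  have hs' := (continuous_sphMap R).measurable hs
  rw [Measure.map_apply (continuous_sphMap R).measurable hs, Measure.toSphere_apply' _ hs,
    Measure.toSphere_apply' _ hs']
  congr 1
  have : Set.Ioo (0 : ℝ) 1 • ((↑) '' (sphMap R ⁻¹' s) : Set E3)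
      = R ⁻¹' (Set.Ioo (0 : ℝ) 1 • ((↑) '' s : Set E3)) := by
    ext y
    simp only [Set.mem_smul, Set.mem_image, Set.mem_preimage]
    constructor
    · rintro ⟨r, hr, _, ⟨x, hx, rfl⟩, rfl⟩
      exact ⟨r, hr, _, ⟨sphMap R x, hx, rfl⟩, by simp⟩
    · rintro ⟨r, hr, _, ⟨x, hx, rfl⟩, h⟩
      refine ⟨r, hr, _, ⟨sphMap R.symm x, ?_, rfl⟩, ?_⟩
      · convert hx
        ext1
        simp
      · rw [coe_sphMap, ← map_smul, h, R.symm_apply_apply]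
  rw [this, R.measurePreserving.measure_preimage_emb R.toHomeomorph.measurableEmbedding]

theorem measurePreserving_sphMap (R : E3 ≃ₗᵢ[ℝ] E3) : MeasurePreserving (sphMap R) dω dω :=
  (measurePreserving_sphMap_toSphere R).smul_measure _

theorem integral_comp_sphMap (R : E3 ≃ₗᵢ[ℝ] E3) {g : S2 → ℝ} (hg : Continuous g) :
    ∫ x, g (sphMap R x) ∂dω = ∫ x, g x ∂dω := by
  have h := measurePreserving_sphMap R
  conv_rhs => rw [← h.map_eq]
  rw [integral_map h.measurable.aemeasurable hg.aestronglyMeasurable]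

theorem Continuous.integrable_sphere {F : Type*} [NormedAddCommGroup F]
    {g : S2 → F} (hg : Continuous g) : Integrable g dω :=
  hg.integrable_of_hasCompactSupport (HasCompactSupport.of_compactSpace g)

/-! ### Rotation fields and integration by parts -/

/-- Functions are integrated by parts along a skew field `A`: its flow `exp (t A)` preserves the
surface measure, so the `A`-derivative of a smooth function has mean zero. -/
theorem integral_fderiv_skew {A : E3 →L[ℝ] E3} (hA : A ∈ skewAdjoint (E3 →L[ℝ] E3))
    {h : E3 → ℝ} (hh : ContDiff ℝ 1 h) : ∫ x : S2, fderiv ℝ h x (A x) ∂dω = 0 := by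
  let _ : NormedAlgebra ℚ (E3 →L[ℝ] E3) := NormedAlgebra.restrictScalars ℚ ℝ _
  have hu (t : ℝ) : NormedSpace.exp (t • A) ∈ unitary (E3 →L[ℝ] E3) :=
    NormedSpace.exp_mem_unitary_of_mem_skewAdjoint (skewAdjoint.smul_mem t hA)
  set R : ℝ → (E3 ≃ₗᵢ[ℝ] E3) := fun t => Unitary.linearIsometryEquiv ⟨_, hu t⟩ with hR
  have hRx (t : ℝ) (x : E3) : R t x = NormedSpace.exp (t • A) x := rfl
  set g : S2 → ℝ := fun x => fderiv ℝ h x (A x) with hg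
  have hgc : Continuous g := by
    have := hh.continuous_fderiv (by simp)
    exact (this.comp continuous_subtype_val).clm_apply (A.continuous.comp continuous_subtype_val)
  obtain ⟨C, hC⟩ := (isCompact_range hgc).isBounded.exists_norm_le
  have hd (x : S2) (t : ℝ) : HasDerivAt (fun t => h (R t x)) (g (sphMap (R t) x)) t := by
    have h1 : HasDerivAt (fun t : ℝ => R t x) (A (R t x)) t :=
      (hasDerivAt_exp_smul_const' (𝕂 := ℝ) A t).clm_apply (hasDerivAt_const t (x : E3)) |>.congr_deriv
        (by simp [hRx])
    exact ((hh.differentiable (by simp) _).hasFDerivAt).comp_hasDerivAt t h1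
  have key := (hasDerivAt_integral_of_dominated_loc_of_deriv_le (μ := dω) (x₀ := (0 : ℝ))
    (F := fun t (x : S2) => h (R t x)) (F' := fun t x => g (sphMap (R t) x)) (s := Set.univ)
    (bound := fun _ => C) Filter.univ_mem
    (.of_forall fun t => ((hh.continuous.comp continuous_subtype_val).comp
      (continuous_sphMap (R t))).aestronglyMeasurable)
    ((hh.continuous.comp continuous_subtype_val).comp (continuous_sphMap (R 0))).integrable_sphere
    (hgc.comp (continuous_sphMap (R 0))).aestronglyMeasurable
    (.of_forall fun x t _ => hC _ ⟨_, rfl⟩) (integrable_const C)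
    (.of_forall fun x t _ => hd x t)).2
  have hconst : (fun t => ∫ x : S2, h (R t x) ∂dω) = fun _ => ∫ x : S2, h x ∂dω := by
    funext t
    exact integral_comp_sphMap (R t) (g := fun x => h x) (hh.continuous.comp continuous_subtype_val)
  rw [hconst, integral_comp_sphMap _ hgc] at key
  exact key.unique (hasDerivAt_const _ _)

/-- The infinitesimal rotation `x ↦ eₖ × x` of `ℝ³`. -/
noncomputable def rotField (k : Fin 3) : E3 →L[ℝ] E3 :=
  (EuclideanSpace.proj (k + 1) : E3 →L[ℝ] ℝ).smulRight (EuclideanSpace.single (k + 2) (1 : ℝ))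
  - (EuclideanSpace.proj (k + 2) : E3 →L[ℝ] ℝ).smulRight (EuclideanSpace.single (k + 1) (1 : ℝ))

theorem inner_rotField (k : Fin 3) (a x : E3) :
    inner ℝ a (rotField k x) = x (k + 1) * a (k + 2) - x (k + 2) * a (k + 1) := by
  simp [rotField, inner_sub_right, inner_smul_right, EuclideanSpace.inner_single_right]

theorem rotField_mem_skewAdjoint (k : Fin 3) : rotField k ∈ skewAdjoint (E3 →L[ℝ] E3) := by
  rw [skewAdjoint.mem_iff]
  ext1 x
  refine ext_inner_left ℝ fun a => ?_
  rw [ContinuousLinearMap.star_eq_adjoint, ContinuousLinearMap.adjoint_inner_right,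
    real_inner_comm, inner_rotField, neg_apply, inner_neg_right, inner_rotField]
  ring

theorem inner_self_rotField (k : Fin 3) (x : E3) : inner ℝ x (rotField k x) = 0 := by
  rw [inner_rotField]; ring

/-- Lagrange's identity: at a point of the sphere, the rotation fields span the tangent plane
isometrically. -/
theorem sum_inner_rotField (x : S2) (v b : E3) :
    ∑ k, inner ℝ v (rotField k x) * inner ℝ b (rotField k x)
      = inner ℝ v (b - inner ℝ b (x : E3) • (x : E3)) := by
  have hx : (x : E3) 0 ^ 2 + (x : E3) 1 ^ 2 + (x : E3) 2 ^ 2 = 1 := by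
    have := norm_eq_of_mem_sphere x
    rw [EuclideanSpace.norm_eq, Real.sqrt_eq_one, Fin.sum_univ_three] at this
    simpa using this
  simp only [inner_rotField, inner_sub_right, inner_smul_right]
  simp only [Fin.sum_univ_three, PiLp.inner_apply, RCLike.inner_apply, conj_trivial, Fin.isValue,
    Fin.reduceAdd, zero_add]
  generalize (x : E3) 0 = x0 at *
  generalize (x : E3) 1 = x1 at *
  generalize (x : E3) 2 = x2 at *
  linear_combination (v 0 * b 0 + v 1 * b 1 + v 2 * b 2) * hx

theorem continuous_rotField_sphere (k : Fin 3) : Continuous fun x : S2 => rotField k x :=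
  (rotField k).continuous.comp continuous_subtype_val

theorem ContDiff.continuous_gradient {f : E3 → ℝ} (hf : ContDiff ℝ ∞ f) :
    Continuous (gradient f) := by
  unfold gradient
  exact (LinearIsometryEquiv.continuous _).comp (hf.continuous_fderiv (by simp))

theorem ContDiff.continuous_sphGrad {f : E3 → ℝ} (hf : ContDiff ℝ ∞ f) : Continuous (sphGrad f) := by
  have := hf.continuous_gradient
  unfold sphGrad
  fun_prop

/-- The derivative of `f` along the rotation field `k`, in terms of the spherical gradient. -/
theorem inner_sphGrad_rotField (f : E3 → ℝ) (k : Fin 3) (x : S2) :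
    inner ℝ (sphGrad f x) (rotField k x) = fderiv ℝ f x (rotField k x) := by
  rw [sphGrad, inner_sub_left, inner_smul_left, inner_self_rotField, mul_zero, sub_zero,
    gradient, InnerProductSpace.toDual_symm_apply]

/-- The spherical gradient, tested against an arbitrary vector, in terms of rotation fields. -/
theorem inner_sphGrad_eq_sum (f : E3 → ℝ) (x : S2) (v : E3) :
    inner ℝ v (sphGrad f x) = ∑ k, inner ℝ v (rotField k x) * fderiv ℝ f x (rotField k x) := by
  have := sum_inner_rotField x v (gradient f x)
  rw [sphGrad, ← this]
  simp only [gradient, InnerProductSpace.toDual_symm_apply]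

theorem inner_sphGrad_self (f : E3 → ℝ) (x : S2) : inner ℝ (sphGrad f x) (x : E3) = 0 := by
  rw [sphGrad, inner_sub_left, inner_smul_left, real_inner_self_eq_norm_sq, norm_eq_of_mem_sphere]
  simp

/-! ### Polynomials on the sphere -/

/-- The function on `ℝ³` defined by a polynomial in three variables. -/
noncomputable def polyFun (p : MvPolynomial (Fin 3) ℝ) (x : E3) : ℝ :=
  MvPolynomial.eval (fun i => x i) p

@[simp] theorem polyFun_add (p q : MvPolynomial (Fin 3) ℝ) (x : E3) :
    polyFun (p + q) x = polyFun p x + polyFun q x := by simp [polyFun]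
@[simp] theorem polyFun_sub (p q : MvPolynomial (Fin 3) ℝ) (x : E3) :
    polyFun (p - q) x = polyFun p x - polyFun q x := by simp [polyFun]
@[simp] theorem polyFun_neg (p : MvPolynomial (Fin 3) ℝ) (x : E3) :
    polyFun (-p) x = -polyFun p x := by simp [polyFun]
@[simp] theorem polyFun_mul (p q : MvPolynomial (Fin 3) ℝ) (x : E3) :
    polyFun (p * q) x = polyFun p x * polyFun q x := by simp [polyFun]
@[simp] theorem polyFun_C (c : ℝ) (x : E3) : polyFun (.C c) x = c := by simp [polyFun]
@[simp] theorem polyFun_one (x : E3) : polyFun 1 x = 1 := by simp [polyFun]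
@[simp] theorem polyFun_X (i : Fin 3) (x : E3) : polyFun (.X i) x = x i := by simp [polyFun]
@[simp] theorem polyFun_sum {ι : Type*} (s : Finset ι) (p : ι → MvPolynomial (Fin 3) ℝ) (x : E3) :
    polyFun (∑ i ∈ s, p i) x = ∑ i ∈ s, polyFun (p i) x := by simp [polyFun]

theorem contDiff_polyFun (p : MvPolynomial (Fin 3) ℝ) : ContDiff ℝ ∞ (polyFun p) := by
  induction p using MvPolynomial.induction_on with
  | C a =>
    simp only [funext fun x => polyFun_C a x]
    exact contDiff_const
  | add p q hp hq =>
    simp only [funext fun x => polyFun_add p q x]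
    exact hp.add hq
  | mul_X p i hp =>
    simp only [funext fun x => polyFun_mul p (.X i) x, polyFun_X]
    exact hp.mul (EuclideanSpace.proj (𝕜 := ℝ) i : E3 →L[ℝ] ℝ).contDiff

theorem hasFDerivAt_polyFun (p : MvPolynomial (Fin 3) ℝ) (x : E3) :
    HasFDerivAt (polyFun p)
      (∑ i, polyFun (MvPolynomial.pderiv i p) x • (EuclideanSpace.proj (𝕜 := ℝ) i : E3 →L[ℝ] ℝ)) x := by
  induction p using MvPolynomial.induction_on with
  | C a =>
    simp only [funext fun x => polyFun_C a x]
    convert! hasFDerivAt_const a x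
    simp [polyFun]
  | add p q hp hq =>
    simp only [funext fun x => polyFun_add p q x]
    convert! hp.add hq
    simp [add_smul, Finset.sum_add_distrib]
  | mul_X p i hp =>
    simp only [funext fun x => polyFun_mul p (.X i) x, polyFun_X]
    convert! hp.mul (EuclideanSpace.proj (𝕜 := ℝ) i : E3 →L[ℝ] ℝ).hasFDerivAt using 1
    ext v
    simp [Derivation.leibniz, MvPolynomial.pderiv_X, add_mul, Finset.sum_add_distrib,
      Finset.mul_sum, Pi.single_apply, polyFun, mul_assoc,
      apply_ite (MvPolynomial.eval fun i => x.ofLp i)]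

theorem fderiv_polyFun (p : MvPolynomial (Fin 3) ℝ) (x v : E3) :
    fderiv ℝ (polyFun p) x v = ∑ i, polyFun (MvPolynomial.pderiv i p) x * v i := by
  simp [(hasFDerivAt_polyFun p x).fderiv]

/-- The restriction of polynomials to the sphere, as an algebra homomorphism. -/
noncomputable def polyC : MvPolynomial (Fin 3) ℝ →ₐ[ℝ] C(S2, ℝ) :=
  MvPolynomial.aeval fun i => ⟨fun x => (x : E3) i, by fun_prop⟩

theorem polyC_apply (p : MvPolynomial (Fin 3) ℝ) (x : S2) : polyC p x = polyFun p x := by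
  induction p using MvPolynomial.induction_on with
  | C a => simp [polyC]
  | add p q hp hq => simp [hp, hq]
  | mul_X p i hp => rw [map_mul, ContinuousMap.mul_apply, hp]; simp [polyC]

/-- Polynomials as elements of `L²(𝕊²)`. -/
noncomputable def polyLp : MvPolynomial (Fin 3) ℝ →ₗ[ℝ] Lp ℝ 2 dω :=
  (ContinuousMap.toLp (E := ℝ) 2 dω ℝ : C(S2, ℝ) →ₗ[ℝ] Lp ℝ 2 dω) ∘ₗ polyC.toLinearMap

theorem coeFn_polyLp (p : MvPolynomial (Fin 3) ℝ) :
    (polyLp p : S2 → ℝ) =ᵐ[dω] fun x => polyFun p x := by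
  filter_upwards [ContinuousMap.coeFn_toLp (p := 2) (𝕜 := ℝ) dω (polyC p)] with x hx
  rw [← polyC_apply, ← hx]
  rfl

theorem denseRange_polyLp : DenseRange polyLp := by
  have h1 : DenseRange (polyC : MvPolynomial (Fin 3) ℝ → C(S2, ℝ)) := by
    have := ContinuousMap.subalgebra_topologicalClosure_eq_top_of_separatesPoints polyC.range
      (by
        intro x y hxy
        obtain ⟨i, hi⟩ : ∃ i, (x : E3) i ≠ (y : E3) i := by
          by_contra! h
          exact hxy (Subtype.ext (PiLp.ext h))
        exact ⟨_, ⟨polyC (.X i), ⟨_, rfl⟩, rfl⟩, by simpa [polyC_apply] using hi⟩)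
    intro g
    have hg : g ∈ polyC.range.topologicalClosure := by rw [this]; trivial
    exact hg
  exact (ContinuousMap.toLp_denseRange ℝ dω ℝ (p := 2) (by simp)).comp h1
    (ContinuousMap.toLp (E := ℝ) 2 dω ℝ).continuous

/-! ### Integration by parts in `H¹` -/

theorem continuous_integral_inner {F : Type*} [NormedAddCommGroup F] [InnerProductSpace ℝ F]
    [SecondCountableTopology F] [MeasurableSpace F] [BorelSpace F] {w : S2 → F}
    (hw : Continuous w) : Continuous fun u : Lp F 2 dω => ∫ x, inner ℝ (w x) (u x) ∂dω := by
  have hm : MemLp w 2 dω := hw.memLp_of_hasCompactSupport (HasCompactSupport.of_compactSpace w)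
  have : (fun u : Lp F 2 dω => ∫ x, inner ℝ (w x) (u x) ∂dω) = fun u => inner ℝ (hm.toLp w) u := by
    funext u
    rw [L2.inner_def]
    refine integral_congr_ae ?_
    filter_upwards [hm.coeFn_toLp] with x hx
    rw [hx]
  rw [this]
  fun_prop

theorem inner_polyLp (p : MvPolynomial (Fin 3) ℝ) (u : Lp ℝ 2 dω) :
    inner ℝ (polyLp p) u = ∫ x, polyFun p x * u x ∂dω := by
  rw [L2.inner_def]
  refine integral_congr_ae ?_
  filter_upwards [coeFn_polyLp p] with x hx
  rw [hx]
  simp [mul_comm]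

theorem eq_zero_of_integral_polyFun_mul {u : Lp ℝ 2 dω}
    (h : ∀ p, ∫ x, polyFun p x * u x ∂dω = 0) : u = 0 := by
  refine denseRange_polyLp.eq_zero_of_inner_left ℝ ?_
  intro p
  rw [real_inner_comm, inner_polyLp, h]

/-- A closed condition that holds for smooth functions and their gradients holds on `H¹`. -/
theorem H1.induction_smooth {P : Lp ℝ 2 dω × Lp E3 2 dω → Prop} (hP : IsClosed {p | P p})
    (hs : ∀ (p : Lp ℝ 2 dω × Lp E3 2 dω) (f : E3 → ℝ), ContDiff ℝ ∞ f →
      (p.1 : S2 → ℝ) =ᵐ[dω] (fun x => f x) → (p.2 : S2 → E3) =ᵐ[dω] sphGrad f → P p)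
    (φ : H1) : P φ := by
  have h : (smoothGraph : Set _) ⊆ {p | P p} := fun p ⟨f, hf, h1, h2⟩ => hs p f hf h1 h2
  exact closure_minimal h hP φ.2

/-- Integration by parts along a rotation field, against a smooth function. -/
theorem H1.integral_grad_rotField (φ : H1) (k : Fin 3) {q : E3 → ℝ} (hq : ContDiff ℝ ∞ q) :
    ∫ x, q x * inner ℝ (φ.grad x) (rotField k x) ∂dω
      = - ∫ x, fderiv ℝ q x (rotField k x) * φ.val x ∂dω := by
  have hqc : Continuous fun x : S2 => q x := hq.continuous.comp continuous_subtype_val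
  have hqd : Continuous fun x : S2 => fderiv ℝ q x (rotField k x) :=
    ((hq.continuous_fderiv (by simp)).comp continuous_subtype_val).clm_apply
      (continuous_rotField_sphere k)
  have hc1 : Continuous fun u : Lp ℝ 2 dω × Lp E3 2 dω =>
      ∫ x, q x * inner ℝ (u.2 x) (rotField k x) ∂dω := by
    have := (continuous_integral_inner (w := fun x : S2 => q x • rotField k x)
      (hqc.smul (continuous_rotField_sphere k))).comp
      (continuous_snd : Continuous fun u : Lp ℝ 2 dω × Lp E3 2 dω => u.2)
    convert! this using 5
    simp [inner_smul_left, real_inner_comm]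
  have hc2 : Continuous fun u : Lp ℝ 2 dω × Lp E3 2 dω =>
      - ∫ x, fderiv ℝ q x (rotField k x) * u.1 x ∂dω := by
    have := ((continuous_integral_inner hqd).comp
      (continuous_fst : Continuous fun u : Lp ℝ 2 dω × Lp E3 2 dω => u.1)).neg
    convert! this using 5
    simp [mul_comm]
  refine H1.induction_smooth (isClosed_eq hc1 hc2) ?_ φ
  intro p f hf h1 h2
  have hfc : Continuous fun x : S2 => f x := hf.continuous.comp continuous_subtype_val
  have hfd : Continuous fun x : S2 => fderiv ℝ f x (rotField k x) :=
    ((hf.continuous_fderiv (by simp)).comp continuous_subtype_val).clm_apply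
      (continuous_rotField_sphere k)
  have e1 : ∫ x, q x * inner ℝ (p.2 x) (rotField k x) ∂dω
      = ∫ x : S2, q x * fderiv ℝ f x (rotField k x) ∂dω := by
    refine integral_congr_ae ?_
    filter_upwards [h2] with x hx
    rw [hx, inner_sphGrad_rotField]
  have e2 : ∫ x, fderiv ℝ q x (rotField k x) * p.1 x ∂dω
      = ∫ x : S2, fderiv ℝ q x (rotField k x) * f x ∂dω := by
    refine integral_congr_ae ?_
    filter_upwards [h1] with x hx
    rw [hx]
  have := integral_fderiv_skew (rotField_mem_skewAdjoint k) ((hq.mul hf).of_le (by simp))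
  have e3 (x : S2) : fderiv ℝ (fun y => q y * f y) x (rotField k x)
      = q x * fderiv ℝ f x (rotField k x) + fderiv ℝ q x (rotField k x) * f x := by
    rw [fderiv_fun_mul (hq.differentiable (by simp) _) (hf.differentiable (by simp) _)]
    simp [mul_comm]
  change ∫ x : S2, fderiv ℝ (fun y => q y * f y) x (rotField k x) ∂dω = 0 at this
  simp only [e3] at this
  have hi1 : Integrable (fun x : S2 => q x * fderiv ℝ f x (rotField k x)) dω :=
    (hqc.mul hfd).integrable_sphere
  have hi2 : Integrable (fun x : S2 => fderiv ℝ q x (rotField k x) * f x) dω :=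
    (hqd.mul hfc).integrable_sphere
  rw [integral_add hi1 hi2] at this
  rw [e1, e2]
  linarith

theorem H1.memLp_val (φ : H1) : MemLp φ.val 2 dω := Lp.memLp _

theorem ae_inner_eq_zero {v : Lp E3 2 dω} {w : S2 → E3} (hw : Continuous w)
    (h : ∀ p, ∫ x, polyFun p x * inner ℝ (v x) (w x) ∂dω = 0) :
    ∀ᵐ x ∂dω, inner ℝ (v x) (w x) = 0 := by
  have hm : MemLp (fun x => inner ℝ (v x) (w x)) 2 dω := by
    obtain ⟨C, hC⟩ := (isCompact_range hw).isBounded.exists_norm_le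
    refine MemLp.of_le_mul (Lp.memLp v) (c := C) ?_ (.of_forall fun x => ?_)
    · exact (Lp.memLp v).1.inner hw.aestronglyMeasurable
    · refine (norm_inner_le_norm _ _).trans ?_
      rw [mul_comm]
      gcongr
      exact hC _ ⟨x, rfl⟩
  have h0 : hm.toLp _ = 0 := by
    refine eq_zero_of_integral_polyFun_mul fun p => ?_
    rw [← h p]
    refine integral_congr_ae ?_
    filter_upwards [hm.coeFn_toLp] with x hx
    rw [hx]
  filter_upwards [hm.coeFn_toLp, (Lp.eq_zero_iff_ae_eq_zero.1 h0)] with x h1 h2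
  rw [← h1, h2]
  rfl

/-- Gradients of `H¹` functions are tangent to the sphere. -/
theorem H1.ae_inner_grad_self (φ : H1) : ∀ᵐ x ∂dω, inner ℝ (φ.grad x) (x : E3) = 0 := by
  refine ae_inner_eq_zero continuous_subtype_val fun p => ?_
  have hc : Continuous fun u : Lp ℝ 2 dω × Lp E3 2 dω =>
      ∫ x, polyFun p x * inner ℝ (u.2 x) (x : E3) ∂dω := by
    have := (continuous_integral_inner (w := fun x : S2 => polyFun p x • (x : E3))
      (((contDiff_polyFun p).continuous.comp continuous_subtype_val).smul
        continuous_subtype_val)).comp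
      (continuous_snd : Continuous fun u : Lp ℝ 2 dω × Lp E3 2 dω => u.2)
    convert! this using 5
    simp [inner_smul_left, real_inner_comm]
  refine H1.induction_smooth (isClosed_eq hc (continuous_const (y := (0 : ℝ)))) ?_ φ
  intro u f hf _ h2
  refine integral_eq_zero_of_ae ?_
  filter_upwards [h2] with x hx
  simp [hx, inner_sphGrad_self]

/-- The gradient is closable: an element of `H¹` is determined by its function. -/
theorem H1.eq_zero_of_val {φ : H1} (h : φ.val =ᵐ[dω] 0) : φ = 0 := by
  have hk (k : Fin 3) : ∀ᵐ x ∂dω, inner ℝ (φ.grad x) (rotField k x) = 0 := by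
    refine ae_inner_eq_zero (continuous_rotField_sphere k) fun p => ?_
    refine (φ.integral_grad_rotField k (contDiff_polyFun p)).trans ?_
    rw [neg_eq_zero]
    refine integral_eq_zero_of_ae ?_
    filter_upwards [h] with x hx
    simp [hx]
  have hg : φ.grad =ᵐ[dω] 0 := by
    filter_upwards [ae_all_iff.2 hk, φ.ae_inner_grad_self] with x h1 h2
    have := sum_inner_rotField x (φ.grad x) (φ.grad x)
    simp only [h1, h2, zero_smul, sub_zero, mul_zero, Finset.sum_const_zero] at this
    exact inner_self_eq_zero.1 this.symm
  refine Subtype.ext (Prod.ext ?_ ?_)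
  · exact Lp.eq_zero_iff_ae_eq_zero.2 h
  · exact Lp.eq_zero_iff_ae_eq_zero.2 hg

/-! ### The spherical Laplacian on polynomials -/

/-- The rotation field `k` as a derivation of the polynomial ring. -/
noncomputable def rotD (k : Fin 3) :
    Derivation ℝ (MvPolynomial (Fin 3) ℝ) (MvPolynomial (Fin 3) ℝ) :=
  (MvPolynomial.X (k + 1) : MvPolynomial (Fin 3) ℝ) • MvPolynomial.pderiv (k + 2)
    - (MvPolynomial.X (k + 2) : MvPolynomial (Fin 3) ℝ) • MvPolynomial.pderiv (k + 1)

theorem rotD_apply (k : Fin 3) (p : MvPolynomial (Fin 3) ℝ) :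
    rotD k p = .X (k + 1) * MvPolynomial.pderiv (k + 2) p
      - .X (k + 2) * MvPolynomial.pderiv (k + 1) p := rfl

theorem polyFun_rotD (k : Fin 3) (p : MvPolynomial (Fin 3) ℝ) (x : E3) :
    polyFun (rotD k p) x = fderiv ℝ (polyFun p) x (rotField k x) := by
  have := inner_rotField k (WithLp.toLp 2 fun i => polyFun (MvPolynomial.pderiv i p) x) x
  rw [rotD_apply, polyFun_sub, polyFun_mul, polyFun_mul, polyFun_X, polyFun_X, fderiv_polyFun]
  rw [PiLp.inner_apply] at this
  simp only [RCLike.inner_apply, conj_trivial] at this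
  rw [← this]
  simp only [mul_comm]

/-- Minus the spherical Laplacian, acting on polynomials as `-∑ₖ (rotD k)²`. -/
noncomputable def sphLap : MvPolynomial (Fin 3) ℝ →ₗ[ℝ] MvPolynomial (Fin 3) ℝ :=
  - ∑ k, (rotD k : MvPolynomial (Fin 3) ℝ →ₗ[ℝ] MvPolynomial (Fin 3) ℝ) ∘ₗ (rotD k)

theorem sphLap_apply (p : MvPolynomial (Fin 3) ℝ) : sphLap p = -∑ k, rotD k (rotD k p) := by
  simp [sphLap]

theorem pderiv_comm (i j : Fin 3) (p : MvPolynomial (Fin 3) ℝ) :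
    MvPolynomial.pderiv i (MvPolynomial.pderiv j p)
      = MvPolynomial.pderiv j (MvPolynomial.pderiv i p) := by
  have : ⁅(MvPolynomial.pderiv i : Derivation ℝ (MvPolynomial (Fin 3) ℝ) (MvPolynomial (Fin 3) ℝ)),
      (MvPolynomial.pderiv j : Derivation ℝ (MvPolynomial (Fin 3) ℝ) (MvPolynomial (Fin 3) ℝ))⁆
        = 0 := by
    refine MvPolynomial.derivation_ext fun k => ?_
    rw [Derivation.commutator_apply, MvPolynomial.pderiv_X, MvPolynomial.pderiv_X,
      Pi.single_apply, Pi.single_apply]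
    split_ifs <;> simp
  have h := congrArg (fun D => D p) this
  simpa [Derivation.commutator_apply, sub_eq_zero] using h

theorem isHomogeneous_X_mul_pderiv {n : ℕ} {p : MvPolynomial (Fin 3) ℝ} (hp : p.IsHomogeneous n)
    (i j : Fin 3) : (MvPolynomial.X i * MvPolynomial.pderiv j p).IsHomogeneous n := by
  rcases n with _ | n
  · rw [← MvPolynomial.totalDegree_zero_iff_isHomogeneous,
      MvPolynomial.totalDegree_eq_zero_iff_eq_C] at hp
    rw [hp]
    simpa using MvPolynomial.isHomogeneous_zero _ _ _
  · rw [add_comm]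
    exact (MvPolynomial.isHomogeneous_X _ _).mul hp.pderiv

theorem isHomogeneous_rotD {n : ℕ} {p : MvPolynomial (Fin 3) ℝ} (hp : p.IsHomogeneous n)
    (k : Fin 3) : (rotD k p).IsHomogeneous n :=
  (isHomogeneous_X_mul_pderiv hp _ _).sub (isHomogeneous_X_mul_pderiv hp _ _)

theorem isHomogeneous_sphLap {n : ℕ} {p : MvPolynomial (Fin 3) ℝ} (hp : p.IsHomogeneous n) :
    (sphLap p).IsHomogeneous n := by
  rw [sphLap_apply]
  exact (MvPolynomial.IsHomogeneous.sum _ _ _ fun k _ =>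
    isHomogeneous_rotD (isHomogeneous_rotD hp k) k).neg

/-- The spherical Laplacian of a homogeneous polynomial, in terms of the Euclidean one. -/
theorem sphLap_of_isHomogeneous {n : ℕ} {p : MvPolynomial (Fin 3) ℝ} (hp : p.IsHomogeneous n) :
    sphLap p = ((n : ℝ) * (n + 1)) • p
      - (∑ i, .X i ^ 2) * ∑ i, MvPolynomial.pderiv i (MvPolynomial.pderiv i p) := by
  -- Euler's identity and its derivatives
  have h := hp.sum_X_mul_pderiv
  have h' (j : Fin 3) := congrArg (fun q => MvPolynomial.X j * MvPolynomial.pderiv j q) h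
  have h0 := h' 0
  have h1 := h' 1
  have h2 := h' 2
  have hc : ((n : ℝ) * (n + 1)) • p = ((n : MvPolynomial (Fin 3) ℝ) * (n + 1)) * p := by
    rw [MvPolynomial.smul_eq_C_mul]; simp
  simp only [Fin.sum_univ_three, map_add, Derivation.leibniz, smul_eq_mul, Derivation.map_natCast,
    MvPolynomial.pderiv_X, nsmul_eq_mul, Pi.single_apply, Fin.isValue] at h h0 h1 h2
  simp only [sphLap_apply, rotD_apply, Fin.sum_univ_three, map_sub, Derivation.leibniz, smul_eq_mul,
    MvPolynomial.pderiv_X, Pi.single_apply, Fin.isValue, Fin.reduceAdd, zero_add, hc]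
  simp only [Fin.isValue, ↓reduceIte, Fin.reduceEq, pderiv_comm 1 0, pderiv_comm 2 0,
    pderiv_comm 2 1, mul_one, mul_zero, add_zero, one_ne_zero, zero_ne_one] at h0 h1 h2 ⊢
  linear_combination (1 + (n : MvPolynomial (Fin 3) ℝ)) * h + h0 + h1 + h2

/-! ### The spectral gap -/

/-- The polynomials of degree at most `N`, as a subspace of `L²(𝕊²)`. -/
noncomputable def polySpace (N : ℕ) : Submodule ℝ (Lp ℝ 2 dω) :=
  (MvPolynomial.restrictTotalDegree (Fin 3) ℝ N).map polyLp

instance (N : ℕ) : FiniteDimensional ℝ (polySpace N) := by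
  unfold polySpace
  infer_instance

theorem polyLp_mem_polySpace {N : ℕ} {p : MvPolynomial (Fin 3) ℝ} (hp : p.totalDegree ≤ N) :
    polyLp p ∈ polySpace N :=
  ⟨p, (MvPolynomial.mem_restrictTotalDegree _ _ _).2 hp, rfl⟩

theorem polySpace_mono : Monotone polySpace := fun M N h => by
  rintro _ ⟨p, hp, rfl⟩
  exact polyLp_mem_polySpace (((MvPolynomial.mem_restrictTotalDegree _ _ _).1 hp).trans h)

/-- A linear condition on polynomials of degree at most `N` may be checked on homogeneous ones. -/
theorem totalDegree_le_induction {N : ℕ} {S : Submodule ℝ (MvPolynomial (Fin 3) ℝ)}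
    (hS : ∀ n ≤ N, ∀ p : MvPolynomial (Fin 3) ℝ, p.IsHomogeneous n → p ∈ S)
    {p : MvPolynomial (Fin 3) ℝ} (hp : p.totalDegree ≤ N) : p ∈ S := by
  rw [← MvPolynomial.sum_homogeneousComponent p]
  refine S.sum_mem fun i hi => hS i ?_ _ (MvPolynomial.homogeneousComponent_isHomogeneous i p)
  have := Finset.mem_range.1 hi
  omega

theorem totalDegree_sphLap_le {N : ℕ} {p : MvPolynomial (Fin 3) ℝ} (hp : p.totalDegree ≤ N) :
    (sphLap p).totalDegree ≤ N := by
  have := totalDegree_le_induction (N := N)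
    (S := (MvPolynomial.restrictTotalDegree (Fin 3) ℝ N).comap sphLap)
    (fun n hn q hq => by
      rw [Submodule.mem_comap, MvPolynomial.mem_restrictTotalDegree]
      exact (isHomogeneous_sphLap hq).totalDegree_le.trans hn) hp
  rwa [Submodule.mem_comap, MvPolynomial.mem_restrictTotalDegree] at this

theorem sum_sq_sphere (x : S2) : ∑ i, (x : E3) i ^ 2 = 1 := by
  have := norm_eq_of_mem_sphere x
  rw [EuclideanSpace.norm_eq, Real.sqrt_eq_one] at this
  simpa using this

theorem polyLp_congr {p q : MvPolynomial (Fin 3) ℝ} (h : ∀ x : S2, polyFun p x = polyFun q x) :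
    polyLp p = polyLp q := by
  refine Lp.ext ?_
  filter_upwards [coeFn_polyLp p, coeFn_polyLp q] with x h1 h2
  rw [h1, h2, h]

/-- On polynomials of degree `N + 1`, the spherical Laplacian is the eigenvalue `(N + 1) (N + 2)`
up to polynomials of lower degree. -/
theorem polyLp_sphLap_sub_mem {N : ℕ} {p : MvPolynomial (Fin 3) ℝ} (hp : p.totalDegree ≤ N + 1) :
    polyLp (sphLap p) - (((N : ℝ) + 1) * (N + 2)) • polyLp p ∈ polySpace N := by
  set T : MvPolynomial (Fin 3) ℝ →ₗ[ℝ] Lp ℝ 2 dω :=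
    polyLp ∘ₗ sphLap - (((N : ℝ) + 1) * (N + 2)) • polyLp with hT
  have := totalDegree_le_induction (N := N + 1) (S := (polySpace N).comap T)
    (fun n hn q hq => ?_) hp
  · exact this
  rw [Submodule.mem_comap]
  change polyLp (sphLap q) - (((N : ℝ) + 1) * (N + 2)) • polyLp q ∈ polySpace N
  rcases hn.lt_or_eq with hn | rfl
  · have hq' : q.totalDegree ≤ N := hq.totalDegree_le.trans (by omega)
    exact Submodule.sub_mem _ (polyLp_mem_polySpace (totalDegree_sphLap_le hq'))
      (Submodule.smul_mem _ _ (polyLp_mem_polySpace hq'))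
  · set Δq := ∑ i, MvPolynomial.pderiv i (MvPolynomial.pderiv i q) with hΔ
    have hd : (-Δq).totalDegree ≤ N := by
      have : Δq.IsHomogeneous (N + 1 - 1 - 1) :=
        MvPolynomial.IsHomogeneous.sum _ _ _ fun i _ => hq.pderiv.pderiv
      exact this.neg.totalDegree_le.trans (by omega)
    have : polyLp (sphLap q) - (((N : ℝ) + 1) * (N + 2)) • polyLp q = polyLp (-Δq) := by
      rw [← map_smul, ← map_sub]
      refine polyLp_congr fun x => ?_
      rw [sphLap_of_isHomogeneous hq, ← hΔ]
      have h1 : polyFun (∑ i, (.X i : MvPolynomial (Fin 3) ℝ) ^ 2) x = 1 := by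
        refine Eq.trans ?_ (sum_sq_sphere x)
        simp [polyFun]
      simp only [polyFun_sub, polyFun_mul, polyFun_neg, h1]
      simp only [polyFun, MvPolynomial.smul_eval]
      push_cast
      ring
    rw [this]
    exact polyLp_mem_polySpace hd

theorem Continuous.memLp_sphere {F : Type*} [NormedAddCommGroup F]
    {w : S2 → F} (hw : Continuous w) (p : ENNReal) : MemLp w p dω :=
  hw.memLp_of_hasCompactSupport (HasCompactSupport.of_compactSpace w)

theorem ContDiff.memLp_sphere {f : E3 → ℝ} (hf : ContDiff ℝ ∞ f) :
    MemLp (fun x : S2 => f x) 2 dω :=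
  Continuous.memLp_sphere (hf.continuous.comp continuous_subtype_val) 2

theorem ContDiff.memLp_sphGrad {f : E3 → ℝ} (hf : ContDiff ℝ ∞ f) : MemLp (sphGrad f) 2 dω :=
  hf.continuous_sphGrad.memLp_sphere 2

/-- A smooth function as an element of `H¹`. -/
noncomputable def H1.ofSmooth {f : E3 → ℝ} (hf : ContDiff ℝ ∞ f) : H1 :=
  ⟨(hf.memLp_sphere.toLp, hf.memLp_sphGrad.toLp),
    subset_closure ⟨f, hf, hf.memLp_sphere.coeFn_toLp, hf.memLp_sphGrad.coeFn_toLp⟩⟩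

theorem H1.val_ofSmooth {f : E3 → ℝ} (hf : ContDiff ℝ ∞ f) :
    (H1.ofSmooth hf).val =ᵐ[dω] fun x => f x := hf.memLp_sphere.coeFn_toLp

theorem H1.grad_ofSmooth {f : E3 → ℝ} (hf : ContDiff ℝ ∞ f) :
    (H1.ofSmooth hf).grad =ᵐ[dω] sphGrad f := hf.memLp_sphGrad.coeFn_toLp

/-- A polynomial as an element of `H¹`. -/
noncomputable def polyH1 (p : MvPolynomial (Fin 3) ℝ) : H1 := H1.ofSmooth (contDiff_polyFun p)

theorem polyH1_fst (p : MvPolynomial (Fin 3) ℝ) : (polyH1 p).1.1 = polyLp p := by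
  refine Lp.ext ?_
  filter_upwards [coeFn_polyLp p, H1.val_ofSmooth (contDiff_polyFun p)] with x h1 h2
  rw [h1, ← h2]
  rfl

/-- Green's formula between `H¹` functions and polynomials. -/
theorem H1.inner_grad_polyH1 (φ : H1) (p : MvPolynomial (Fin 3) ℝ) :
    inner ℝ φ.1.2 (polyH1 p).1.2 = inner ℝ φ.1.1 (polyLp (sphLap p)) := by
  have hi (k : Fin 3) : Integrable
      (fun x : S2 => polyFun (rotD k p) x * inner ℝ (φ.grad x) (rotField k x)) dω := by
    have h1 : MemLp (fun x : S2 => polyFun (rotD k p) x • rotField k x) 2 dω :=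
      (((contDiff_polyFun _).continuous.comp continuous_subtype_val).smul
        (continuous_rotField_sphere k)).memLp_sphere 2
    have := L2.integrable_inner (𝕜 := ℝ) φ.1.2 (h1.toLp _)
    refine this.congr ?_
    filter_upwards [h1.coeFn_toLp] with x hx
    rw [hx, inner_smul_right]
    rfl
  have hj (k : Fin 3) : Integrable
      (fun x : S2 => polyFun (rotD k (rotD k p)) x * φ.val x) dω := by
    have := L2.integrable_inner (𝕜 := ℝ) φ.1.1 (polyLp (rotD k (rotD k p)))
    refine this.congr ?_
    filter_upwards [coeFn_polyLp (rotD k (rotD k p))] with x hx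
    rw [hx]
    simp [H1.val]
  rw [real_inner_comm, real_inner_comm (polyLp _) φ.1.1, inner_polyLp, L2.inner_def]
  have e1 : ∫ x, inner ℝ ((polyH1 p).1.2 x) (φ.1.2 x) ∂dω
      = ∫ x, ∑ k, polyFun (rotD k p) x * inner ℝ (φ.grad x) (rotField k x) ∂dω := by
    refine integral_congr_ae ?_
    filter_upwards [H1.grad_ofSmooth (contDiff_polyFun p)] with x hx
    change inner ℝ ((polyH1 p).grad x) (φ.grad x) = _
    rw [real_inner_comm, polyH1, hx, inner_sphGrad_eq_sum]
    refine Finset.sum_congr rfl fun k _ => ?_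
    rw [polyFun_rotD, mul_comm]
  have e2 : ∫ x, polyFun (sphLap p) x * φ.1.1 x ∂dω
      = ∫ x, -∑ k, polyFun (rotD k (rotD k p)) x * φ.val x ∂dω := by
    refine integral_congr_ae (.of_forall fun x => ?_)
    simp only [sphLap_apply, polyFun_neg, polyFun_sum, neg_mul, Finset.sum_mul]
    rfl
  rw [e1, e2, integral_neg, integral_finsetSum _ fun k _ => hi k,
    integral_finsetSum _ fun k _ => hj k, ← Finset.sum_neg_distrib]
  refine Finset.sum_congr rfl fun k _ => ?_
  rw [φ.integral_grad_rotField k (contDiff_polyFun _)]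
  simp only [polyFun_rotD k (rotD k p)]

theorem inner_sphLap_comm (p q : MvPolynomial (Fin 3) ℝ) :
    inner ℝ (polyLp (sphLap p)) (polyLp q) = inner ℝ (polyLp p) (polyLp (sphLap q)) := by
  have h1 := (polyH1 q).inner_grad_polyH1 p
  have h2 := (polyH1 p).inner_grad_polyH1 q
  rw [polyH1_fst] at h1 h2
  rw [← h2, real_inner_comm, ← h1, real_inner_comm]

/-- The spectral gap for polynomials orthogonal to the affine functions, by induction on the
degree: the part of top degree is an eigenvector. -/
theorem six_mul_norm_sq_le_inner_sphLap {N : ℕ} (hN : 1 ≤ N) :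
    ∀ p : MvPolynomial (Fin 3) ℝ, p.totalDegree ≤ N → polyLp p ∈ (polySpace 1)ᗮ →
      6 * ‖polyLp p‖ ^ 2 ≤ inner ℝ (polyLp (sphLap p)) (polyLp p) := by
  induction N, hN using Nat.le_induction with
  | base =>
    intro p hp ho
    have : polyLp p = 0 := by
      have := ho _ (polyLp_mem_polySpace hp)
      exact inner_self_eq_zero.1 this
    simp [this]
  | succ N hN ih =>
    intro p hp ho
    obtain ⟨q, hq, hqp⟩ : (polySpace N).starProjection (polyLp p) ∈ polySpace N :=
      Submodule.starProjection_apply_mem _ _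
    have hq : q.totalDegree ≤ N := (MvPolynomial.mem_restrictTotalDegree _ _ _).1 hq
    have hw (v) (hv : v ∈ polySpace N) : inner ℝ (polyLp (p - q)) v = 0 := by
      rw [map_sub, hqp]
      exact Submodule.starProjection_inner_eq_zero _ v hv
    have hwd : (p - q).totalDegree ≤ N + 1 :=
      (MvPolynomial.totalDegree_sub _ _).trans (max_le hp (hq.trans (by omega)))
    have hqo : polyLp q ∈ (polySpace 1)ᗮ := by
      have : q = p - (p - q) := by ring
      rw [this, map_sub]
      refine Submodule.sub_mem _ ho fun v hv => ?_
      rw [real_inner_comm, hw v (polySpace_mono hN hv)]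
    have hLw : inner ℝ (polyLp (sphLap (p - q))) (polyLp (p - q))
        = ((N : ℝ) + 1) * (N + 2) * ‖polyLp (p - q)‖ ^ 2 := by
      have := hw _ (polyLp_sphLap_sub_mem hwd)
      rw [inner_sub_right, inner_smul_right, real_inner_self_eq_norm_sq, sub_eq_zero,
        real_inner_comm] at this
      exact this
    have h1 : inner ℝ (polyLp (sphLap (p - q))) (polyLp q) = 0 := by
      rw [inner_sphLap_comm]
      exact hw _ (polyLp_mem_polySpace (totalDegree_sphLap_le hq))
    have h2 : inner ℝ (polyLp (sphLap q)) (polyLp (p - q)) = 0 := by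
      rw [real_inner_comm]
      exact hw _ (polyLp_mem_polySpace (totalDegree_sphLap_le hq))
    have h3 := hw _ (polyLp_mem_polySpace hq)
    have h4 := ih q hq hqo
    have hp : polyLp p = polyLp (p - q) + polyLp q := by simp
    have hLp : polyLp (sphLap p) = polyLp (sphLap (p - q)) + polyLp (sphLap q) := by simp
    have h5 : 6 ≤ ((N : ℝ) + 1) * (N + 2) := by
      have : (1 : ℝ) ≤ N := by exact_mod_cast hN
      nlinarith
    rw [hLp, hp, inner_add_left, inner_add_right, inner_add_right, hLw, h1, h2,
      norm_add_sq_real, h3]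
    nlinarith [mul_le_mul_of_nonneg_right h5 (sq_nonneg ‖polyLp (p - q)‖)]

open Filter Topology in
/-- The spectral gap: functions orthogonal to `1, x₁, x₂, x₃` have Dirichlet energy at least
six times their mass, six being the second positive eigenvalue of the spherical Laplacian. -/
theorem H1.spectral_gap (φ : H1) (h : φ.1.1 ∈ (polySpace 1)ᗮ) :
    6 * ‖φ.1.1‖ ^ 2 ≤ ‖φ.1.2‖ ^ 2 := by
  have hdense : ⊤ ≤ (⨆ N, polySpace N).topologicalClosure := by
    intro u _
    refine closure_mono ?_ (denseRange_polyLp u)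
    rintro _ ⟨p, rfl⟩
    exact Submodule.mem_iSup_of_mem p.totalDegree (polyLp_mem_polySpace le_rfl)
  have hlim := Submodule.starProjection_tendsto_self polySpace polySpace_mono φ.1.1 hdense
  have hlim' : Tendsto (fun N => 6 * ‖(polySpace N).starProjection φ.1.1‖ ^ 2) atTop
      (𝓝 (6 * ‖φ.1.1‖ ^ 2)) := (hlim.norm.pow 2).const_mul 6
  refine le_of_tendsto hlim' ?_
  filter_upwards [eventually_ge_atTop 1] with N hN
  obtain ⟨p, hp, hpφ⟩ : (polySpace N).starProjection φ.1.1 ∈ polySpace N :=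
    Submodule.starProjection_apply_mem _ _
  have hp : p.totalDegree ≤ N := (MvPolynomial.mem_restrictTotalDegree _ _ _).1 hp
  have hw (v) (hv : v ∈ polySpace N) : inner ℝ φ.1.1 v = inner ℝ (polyLp p) v := by
    rw [hpφ, ← sub_eq_zero, ← inner_sub_left]
    exact Submodule.starProjection_inner_eq_zero _ v hv
  have hpo : polyLp p ∈ (polySpace 1)ᗮ := fun v hv => by
    rw [real_inner_comm, ← hw v (polySpace_mono hN hv), real_inner_comm]
    exact h v hv
  rw [← hpφ]
  refine (six_mul_norm_sq_le_inner_sphLap hN p hp hpo).trans ?_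
  have h1 := φ.inner_grad_polyH1 p
  have h2 := (polyH1 p).inner_grad_polyH1 p
  rw [hw _ (polyLp_mem_polySpace (totalDegree_sphLap_le hp))] at h1
  rw [polyH1_fst, real_inner_self_eq_norm_sq] at h2
  have h3 := norm_sub_sq_real φ.1.2 (polyH1 p).1.2
  rw [real_inner_comm]
  nlinarith [sq_nonneg ‖φ.1.2 - (polyH1 p).1.2‖]

/-! ### The cube-face chart of the sphere -/

/-- The point `(s, t, 1)` of the affine plane `x₃ = 1`. -/
noncomputable def facePoint (s t : ℝ) : E3 := !₂[s, t, 1]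

theorem continuous_facePoint : Continuous fun p : ℝ × ℝ => facePoint p.1 p.2 := by
  unfold facePoint
  refine (PiLp.continuous_toLp 2 _).comp (continuous_pi fun i => ?_)
  fin_cases i <;> simp <;> fun_prop

theorem norm_sq_facePoint (s t : ℝ) : ‖facePoint s t‖ ^ 2 = s ^ 2 + t ^ 2 + 1 := by
  rw [EuclideanSpace.norm_sq_eq, Fin.sum_univ_three]
  simp [facePoint]

theorem one_le_norm_facePoint (s t : ℝ) : 1 ≤ ‖facePoint s t‖ := by
  have := norm_sq_facePoint s t
  nlinarith [sq_nonneg s, sq_nonneg t, norm_nonneg (facePoint s t)]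

/-- The radial projection of the plane `x₃ = 1` to the sphere. -/
noncomputable def faceChart (s t : ℝ) : S2 :=
  ⟨‖facePoint s t‖⁻¹ • facePoint s t, by
    have := one_le_norm_facePoint s t
    rw [mem_sphere_zero_iff_norm, norm_smul, norm_inv, norm_norm, inv_mul_cancel₀ (by linarith)]⟩

theorem continuous_faceChart : Continuous fun p : ℝ × ℝ => faceChart p.1 p.2 := by
  refine Continuous.subtype_mk (Continuous.smul (Continuous.inv₀ continuous_facePoint.norm ?_)
    continuous_facePoint) _
  intro p
  have := one_le_norm_facePoint p.1 p.2
  linarith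

/-- The part of the sphere seen through the face `x₃ = 1` of the cube `[-1, 1]³`. -/
def faceSet : Set S2 := {x | |(x : E3) 0| ≤ (x : E3) 2 ∧ |(x : E3) 1| ≤ (x : E3) 2}

theorem measurableSet_faceSet : MeasurableSet faceSet := by
  have h (i : Fin 3) : Continuous fun x : S2 => (x : E3) i := by fun_prop
  exact ((isClosed_le (h 0).abs (h 2)).inter (isClosed_le (h 1).abs (h 2))).measurableSet

theorem coord_sq_add_sq_add_sq (x : S2) : (x : E3) 0 ^ 2 + (x : E3) 1 ^ 2 + (x : E3) 2 ^ 2 = 1 := by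
  simpa [Fin.sum_univ_three] using sum_sq_sphere x

theorem pos_of_mem_faceSet {x : S2} (hx : x ∈ faceSet) : 0 < (x : E3) 2 := by
  have h := coord_sq_add_sq_add_sq x
  obtain ⟨h0, h1⟩ := hx
  by_contra! h2
  have e0 : (x : E3) 0 = 0 := abs_nonpos_iff.1 (h0.trans h2)
  have e1 : (x : E3) 1 = 0 := abs_nonpos_iff.1 (h1.trans h2)
  have e2 : (x : E3) 2 = 0 := le_antisymm h2 ((abs_nonneg _).trans h0)
  rw [e0, e1, e2] at h
  norm_num at h

/-- The area density `x₃⁻³` of the chart is bounded above and below on the face. -/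
theorem inv_cube_bounds {x : S2} (hx : x ∈ faceSet) :
    1 ≤ ((x : E3) 2)⁻¹ ^ 3 ∧ ((x : E3) 2)⁻¹ ^ 3 ≤ 6 := by
  have hp := pos_of_mem_faceSet hx
  have h := coord_sq_add_sq_add_sq x
  have h0 := sq_le_sq' (neg_le_of_abs_le hx.1) (le_of_abs_le hx.1)
  have h1 := sq_le_sq' (neg_le_of_abs_le hx.2) (le_of_abs_le hx.2)
  set z := (x : E3) 2 with hz
  have hz1 : z ≤ 1 := by nlinarith [sq_nonneg ((x : E3) 0), sq_nonneg ((x : E3) 1)]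
  have hw : 1 ≤ z⁻¹ := (one_le_inv₀ hp).2 hz1
  have hw2 : z⁻¹ ^ 2 ≤ 3 := by
    rw [inv_pow, inv_le_iff_one_le_mul₀ (by positivity)]
    linarith
  refine ⟨one_le_pow₀ hw, ?_⟩
  have hw3 : z⁻¹ ≤ 2 := by nlinarith
  nlinarith

theorem faceChart_of_pos {x : S2} (hx : 0 < (x : E3) 2) :
    faceChart ((x : E3) 0 / (x : E3) 2) ((x : E3) 1 / (x : E3) 2) = x := by
  have h1 : facePoint ((x : E3) 0 / (x : E3) 2) ((x : E3) 1 / (x : E3) 2)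
      = ((x : E3) 2)⁻¹ • (x : E3) := by
    ext i
    fin_cases i <;> simp [facePoint, div_eq_inv_mul, hx.ne']
  refine Subtype.ext ?_
  change ‖facePoint _ _‖⁻¹ • facePoint _ _ = (x : E3)
  rw [h1, norm_smul, norm_eq_of_mem_sphere, smul_smul, norm_inv, Real.norm_of_nonneg hx.le,
    mul_one, inv_inv, mul_inv_cancel₀ hx.ne', one_smul]

/-- The integral over the cube face of a function on the sphere. -/
noncomputable def faceIntegral (h : S2 → ENNReal) : ENNReal :=
  ∫⁻ s in Set.Icc (-1 : ℝ) 1, ∫⁻ t in Set.Icc (-1 : ℝ) 1, h (faceChart s t)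

/-- The pyramid over the cube face. -/
def pyramid : Set E3 := {x | 0 < x 2 ∧ x 2 < 1 ∧ |x 0| ≤ x 2 ∧ |x 1| ≤ x 2}

theorem measurableSet_pyramid : MeasurableSet pyramid := by
  have h (i : Fin 3) : Measurable fun x : E3 => x i := by fun_prop
  have h' (i : Fin 3) : Measurable fun x : E3 => |x i| := (h i).abs
  exact (measurableSet_lt measurable_const (h 2)).inter
    ((measurableSet_lt (h 2) measurable_const).inter
      ((measurableSet_le (h' 0) (h 2)).inter (measurableSet_le (h' 1) (h 2))))

/-- The `0`-homogeneous extension of a function on the sphere to the pyramid. -/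
noncomputable def coneFun (h : S2 → ENNReal) : E3 → ENNReal :=
  pyramid.indicator fun x => h (faceChart (x 0 / x 2) (x 1 / x 2))

theorem measurable_coneFun {h : S2 → ENNReal} (hh : Measurable h) : Measurable (coneFun h) := by
  have hi (i : Fin 3) : Measurable fun x : E3 => x i := by fun_prop
  have h1 : Measurable fun x : E3 => ((x 0 / x 2, x 1 / x 2) : ℝ × ℝ) :=
    ((hi 0).div (hi 2)).prodMk ((hi 1).div (hi 2))
  have h2 : Measurable ((fun p : ℝ × ℝ => faceChart p.1 p.2) ∘
    fun x : E3 => ((x 0 / x 2, x 1 / x 2) : ℝ × ℝ)) := continuous_faceChart.measurable.comp h1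
  exact (hh.comp h2).indicator measurableSet_pyramid

theorem lintegral_comp_div {g : ℝ → ENNReal} {z : ℝ} (hz : 0 < z) :
    ∫⁻ x, g (x / z) = ENNReal.ofReal z * ∫⁻ x, g x := by
  have h := Real.map_volume_mul_left (inv_ne_zero hz.ne')
  have he : MeasurableEmbedding fun x : ℝ => z⁻¹ * x :=
    (Homeomorph.mulLeft₀ z⁻¹ (inv_ne_zero hz.ne')).measurableEmbedding
  have := he.lintegral_map (μ := volume) g
  rw [h, lintegral_smul_measure] at this
  simp only [div_eq_inv_mul]
  rw [← this, inv_inv, abs_of_pos hz, smul_eq_mul]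

/-- Fubini's theorem on `ℝ³`, with the third coordinate outermost. -/
theorem lintegral_E3 {K : E3 → ENNReal} (hK : Measurable K) :
    ∫⁻ x, K x = ∫⁻ z : ℝ, ∫⁻ x : ℝ, ∫⁻ y : ℝ, K !₂[x, y, z] := by
  have hK1 : Measurable fun v : Fin 3 → ℝ => K (WithLp.toLp 2 v) := hK.comp (by fun_prop)
  have e1 := (PiLp.volume_preserving_toLp (Fin 3)).lintegral_comp hK
  have e2 := (volume_preserving_piFinSuccAbove (fun _ : Fin 3 => ℝ) 2).symm
  have hK2 : Measurable fun q => K (WithLp.toLp 2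
      ((MeasurableEquiv.piFinSuccAbove (fun _ : Fin 3 => ℝ) 2).symm q)) := hK1.comp e2.measurable
  rw [← e1, ← e2.lintegral_comp hK1, Measure.volume_eq_prod, lintegral_prod _ hK2.aemeasurable]
  refine lintegral_congr fun z => ?_
  have e3 := (volume_preserving_finTwoArrow ℝ).symm
  have hK3 : Measurable fun q => K (WithLp.toLp 2
      ((MeasurableEquiv.piFinSuccAbove (fun _ : Fin 3 => ℝ) 2).symm (z, q))) :=
    hK2.comp (measurable_prodMk_left (x := z))
  have hK4 : Measurable fun q => K (WithLp.toLp 2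
      ((MeasurableEquiv.piFinSuccAbove (fun _ : Fin 3 => ℝ) 2).symm
        (z, MeasurableEquiv.finTwoArrow.symm q))) := hK3.comp e3.measurable
  rw [← e3.lintegral_comp hK3, Measure.volume_eq_prod, lintegral_prod _ hK4.aemeasurable]
  refine lintegral_congr fun x => lintegral_congr fun y => ?_
  congr 1
  ext i
  fin_cases i <;> rfl

/-- Fubini's theorem on the pyramid: the horizontal slices are scaled copies of the face. -/
theorem lintegral_coneFun_eq_face {h : S2 → ENNReal} (hh : Measurable h) :
    ∫⁻ x, coneFun h x = ENNReal.ofReal (1 / 3) * faceIntegral h := by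
  rw [lintegral_E3 (measurable_coneFun hh)]
  set g : ℝ → ℝ → ENNReal := fun s t =>
    (Set.Icc (-1 : ℝ) 1).indicator (fun s => (Set.Icc (-1 : ℝ) 1).indicator
      (fun t => h (faceChart s t)) t) s with hg
  have hgi : ∫⁻ s, ∫⁻ t, g s t = faceIntegral h := by
    rw [faceIntegral, ← lintegral_indicator measurableSet_Icc]
    refine lintegral_congr fun s => ?_
    by_cases hs : s ∈ Set.Icc (-1 : ℝ) 1
    · simp only [hg, Set.indicator_of_mem hs]
      rw [← lintegral_indicator measurableSet_Icc]
    · simp [hg, Set.indicator_of_notMem hs]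
  have key (z : ℝ) : ∫⁻ x : ℝ, ∫⁻ y : ℝ, coneFun h !₂[x, y, z]
      = (Set.Ioo (0 : ℝ) 1).indicator (fun z => ENNReal.ofReal (z ^ 2) * faceIntegral h) z := by
    by_cases hz : z ∈ Set.Ioo (0 : ℝ) 1
    · have hz0 := hz.1
      have e (x y : ℝ) : coneFun h !₂[x, y, z] = g (x / z) (y / z) := by
        have e1 (x : ℝ) : x / z ∈ Set.Icc (-1 : ℝ) 1 ↔ |x| ≤ z := by
          rw [Set.mem_Icc, ← abs_le, abs_div, abs_of_pos hz0, div_le_one hz0]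
        simp only [coneFun, hg, Set.indicator_apply, e1, pyramid, Set.mem_ofPred_eq]
        simp [hz.1, hz.2]
        split_ifs <;> simp_all
      simp only [e]
      rw [Set.indicator_of_mem hz, lintegral_comp_div (g := fun s => ∫⁻ y, g s (y / z)) hz0]
      simp only [lintegral_comp_div hz0]
      rw [lintegral_const_mul' _ _ ENNReal.ofReal_ne_top, hgi, ← mul_assoc,
        ← ENNReal.ofReal_mul hz0.le, sq]
    · rw [Set.indicator_of_notMem hz]
      have e (x y : ℝ) : coneFun h !₂[x, y, z] = 0 := by
        refine Set.indicator_of_notMem (fun hm => hz ⟨?_, ?_⟩) _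
        · simpa using hm.1
        · simpa using hm.2.1
      simp [e]
  simp only [key]
  rw [lintegral_indicator measurableSet_Ioo, lintegral_mul_const _ (by fun_prop)]
  congr 1
  rw [restrict_Ioo_eq_restrict_Ioc, ← ofReal_integral_eq_lintegral_ofReal,
    ← intervalIntegral.integral_of_le zero_le_one]
  · norm_num
  · exact (intervalIntegral.intervalIntegrable_pow 2).1
  · exact .of_forall fun z => sq_nonneg z

/-- Polar coordinates on the pyramid. -/
theorem lintegral_coneFun_eq_polar {h : S2 → ENNReal} (hh : Measurable h) :
    ∫⁻ x, coneFun h x = ∫⁻ x in faceSet, h x * ENNReal.ofReal (((x : E3) 2)⁻¹ ^ 3 / 3)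
      ∂(volume : Measure E3).toSphere := by
  have hm := measurable_coneFun hh
  have h0 : ∫⁻ x, coneFun h x = ∫⁻ x : ({0}ᶜ : Set E3), coneFun h (x : E3) ∂(volume.comap Subtype.val) := by
    rw [lintegral_subtype_comap (measurableSet_singleton _).compl, restrict_compl_singleton]
  have h1 := (volume : Measure E3).measurePreserving_homeomorphUnitSphereProd.symm
    (homeomorphUnitSphereProd E3).toMeasurableEquiv
  have h2 : Measurable fun x : ({0}ᶜ : Set E3) => coneFun h (x : E3) := hm.comp measurable_subtype_coe
  rw [h0, ← h1.lintegral_comp h2, finrank_E3]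
  have h3 : Measurable fun p : S2 × Set.Ioi (0 : ℝ) => coneFun h ((p.2 : ℝ) • (p.1 : E3)) :=
    hm.comp (by fun_prop)
  change ∫⁻ p : S2 × Set.Ioi (0 : ℝ), coneFun h ((p.2 : ℝ) • (p.1 : E3)) ∂_ = _
  rw [lintegral_prod _ h3.aemeasurable, ← lintegral_indicator measurableSet_faceSet]
  refine lintegral_congr fun x => ?_
  by_cases hx : x ∈ faceSet
  · have hp := pos_of_mem_faceSet hx
    rw [Set.indicator_of_mem hx]
    set R : Set.Ioi (0 : ℝ) := ⟨((x : E3) 2)⁻¹, Set.mem_Ioi.2 (inv_pos.2 hp)⟩ with hR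
    have e (r : Set.Ioi (0 : ℝ)) : coneFun h ((r : ℝ) • (x : E3))
        = (Set.Iio R).indicator (fun _ => h x) r := by
      have hr : 0 < (r : ℝ) := r.2
      have e1 : ((r : ℝ) • (x : E3)) ∈ pyramid ↔ r ∈ Set.Iio R := by
        rw [Set.mem_Iio, ← Subtype.coe_lt_coe]
        simp only [pyramid, Set.mem_ofPred_eq, PiLp.smul_apply, smul_eq_mul, abs_mul,
          abs_of_pos hr, mul_le_mul_iff_right₀ hr, hx.1, hx.2, and_true, mul_pos hr hp, true_and]
        rw [lt_inv_comm₀ hr hp, ← one_div, lt_div_iff₀ hr, mul_comm]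
      have e2 : h (faceChart (((r : ℝ) • (x : E3)) 0 / ((r : ℝ) • (x : E3)) 2)
          (((r : ℝ) • (x : E3)) 1 / ((r : ℝ) • (x : E3)) 2)) = h x := by
        simp only [PiLp.smul_apply, smul_eq_mul, mul_div_mul_left _ _ hr.ne', faceChart_of_pos hp]
      by_cases hm : r ∈ Set.Iio R
      · rw [coneFun, Set.indicator_of_mem (e1.2 hm), Set.indicator_of_mem hm, e2]
      · rw [coneFun, Set.indicator_of_notMem (mt e1.1 hm), Set.indicator_of_notMem hm]
    simp only [e]
    rw [lintegral_indicator measurableSet_Iio, setLIntegral_const,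
      Measure.volumeIoiPow_apply_Iio, hR]
    norm_num
  · rw [Set.indicator_of_notMem hx]
    have e (r : Set.Ioi (0 : ℝ)) : coneFun h ((r : ℝ) • (x : E3)) = 0 := by
      have hr : 0 < (r : ℝ) := r.2
      refine Set.indicator_of_notMem (fun hm => hx ?_) _
      simpa [faceSet, pyramid, abs_mul, abs_of_pos hr, hr] using hm.2.2
    simp [e]

theorem setLIntegral_faceSet_le {h : S2 → ENNReal} (hh : Measurable h) :
    ∫⁻ x in faceSet, h x ∂(volume : Measure E3).toSphere ≤ faceIntegral h := by
  have h1 := (lintegral_coneFun_eq_face hh).symm.trans (lintegral_coneFun_eq_polar hh)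
  have h2 : ENNReal.ofReal (1 / 3) * ∫⁻ x in faceSet, h x ∂(volume : Measure E3).toSphere
      ≤ ENNReal.ofReal (1 / 3) * faceIntegral h := by
    rw [h1, ← lintegral_const_mul _ hh]
    refine setLIntegral_mono' measurableSet_faceSet fun x hx => ?_
    rw [mul_comm]
    gcongr
    exact (inv_cube_bounds hx).1
  exact (ENNReal.mul_le_mul_iff_right (by simp) ENNReal.ofReal_ne_top).1 h2

theorem faceIntegral_le {h : S2 → ENNReal} (hh : Measurable h) :
    faceIntegral h ≤ 6 * ∫⁻ x in faceSet, h x ∂(volume : Measure E3).toSphere := by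
  have h1 := (lintegral_coneFun_eq_face hh).symm.trans (lintegral_coneFun_eq_polar hh)
  have h2 : ENNReal.ofReal (1 / 3) * faceIntegral h ≤ ENNReal.ofReal (1 / 3) *
      (6 * ∫⁻ x in faceSet, h x ∂(volume : Measure E3).toSphere) := by
    rw [h1, ← lintegral_const_mul _ hh, ← lintegral_const_mul _ (hh.const_mul _)]
    refine setLIntegral_mono' measurableSet_faceSet fun x hx => ?_
    have e : (6 : ENNReal) = ENNReal.ofReal 6 := by simp
    rw [← mul_assoc, mul_comm, e, ← ENNReal.ofReal_mul (by norm_num)]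
    gcongr
    linarith [(inv_cube_bounds hx).2]
  exact (ENNReal.mul_le_mul_iff_right (by simp) ENNReal.ofReal_ne_top).1 h2

/-! ### The Sobolev inequality `W^{1,1} → L²` -/

/-- The derivative of a function along the radial projection of a curve. -/
theorem hasDerivAt_comp_normalize {f : E3 → ℝ} (hf : ContDiff ℝ ∞ f) {v : ℝ → E3} {e : E3} {s : ℝ}
    (hv : HasDerivAt v e s) (hv0 : v s ≠ 0) (N : S2) (hN : (N : E3) = ‖v s‖⁻¹ • v s) :
    HasDerivAt (fun s => f (‖v s‖⁻¹ • v s)) (‖v s‖⁻¹ * inner ℝ (sphGrad f N) e) s := by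
  have hn : ‖v s‖ ≠ 0 := norm_ne_zero_iff.2 hv0
  have h1 : HasDerivAt (fun s => ‖v s‖) (inner ℝ (N : E3) e) s := by
    have h2 := hv.norm_sq.sqrt (pow_ne_zero 2 hn)
    simp only [Real.sqrt_sq (norm_nonneg _)] at h2
    refine h2.congr_deriv ?_
    rw [hN, inner_smul_left]
    simp
    field_simp
  have h3 := (h1.inv hn).smul hv
  have h4 := (hf.differentiable (by simp) (‖v s‖⁻¹ • v s)).hasFDerivAt.comp_hasDerivAt s h3
  refine h4.congr_deriv ?_
  rw [map_add, map_smul, map_smul, ← hN]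
  have h5 : v s = ‖v s‖ • (N : E3) := by rw [hN, smul_smul, mul_inv_cancel₀ hn, one_smul]
  have h6 (w : E3) : fderiv ℝ f N w = inner ℝ (gradient f N) w := by
    rw [gradient, InnerProductSpace.toDual_symm_apply]
  have h7 : fderiv ℝ f N (v s) = ‖v s‖ * fderiv ℝ f N N := by
    conv_lhs => rw [h5, map_smul, smul_eq_mul]
  rw [h7, h6, h6, sphGrad, inner_sub_left, inner_smul_left]
  simp
  field_simp
  ring

theorem hasDerivAt_facePoint_left (s t : ℝ) :
    HasDerivAt (fun s => facePoint s t) (EuclideanSpace.single 0 1) s := by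
  have h : (fun s => facePoint s t)
      = fun s => facePoint 0 t + s • (EuclideanSpace.single 0 1 : E3) := by
    funext s
    ext i
    fin_cases i <;> simp [facePoint]
  rw [h]
  simpa using ((hasDerivAt_id s).smul_const (EuclideanSpace.single 0 1 : E3)).const_add
    (facePoint 0 t)

theorem hasDerivAt_facePoint_right (s t : ℝ) :
    HasDerivAt (fun t => facePoint s t) (EuclideanSpace.single 1 1) t := by
  have h : (fun t => facePoint s t)
      = fun t => facePoint s 0 + t • (EuclideanSpace.single 1 1 : E3) := by
    funext t
    ext i
    fin_cases i <;> simp [facePoint]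
  rw [h]
  simpa using ((hasDerivAt_id t).smul_const (EuclideanSpace.single 1 1 : E3)).const_add
    (facePoint s 0)

/-- The one-dimensional Sobolev inequality `W^{1,1} → L^∞` on `[-1, 1]`. -/
theorem enorm_le_lintegral_add_deriv {g g' : ℝ → ℝ} (hg : ∀ s, HasDerivAt g (g' s) s)
    (hg' : Continuous g') {s : ℝ} (hs : s ∈ Set.Icc (-1 : ℝ) 1) :
    ‖g s‖ₑ ≤ ∫⁻ r in Set.Icc (-1 : ℝ) 1, (‖g r‖ₑ + ‖g' r‖ₑ) := by
  have hgc : Continuous g := continuous_iff_continuousAt.2 fun s => (hg s).continuousAt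
  set M := ∫⁻ r in Set.Icc (-1 : ℝ) 1, ‖g' r‖ₑ with hM
  have h1 (r : ℝ) (hr : r ∈ Set.Icc (-1 : ℝ) 1) : ‖g s‖ₑ ≤ ‖g r‖ₑ + M := by
    have h2 : ∫ x in r..s, g' x = g s - g r :=
      intervalIntegral.integral_eq_sub_of_hasDerivAt (fun x _ => hg x)
        (hg'.intervalIntegrable _ _)
    have h3 : ‖g s - g r‖ₑ ≤ M := by
      rw [← h2]
      calc ‖∫ x in r..s, g' x‖ₑ = ‖∫ x in Set.uIoc r s, g' x‖ₑ := by
            rw [← ofReal_norm, ← ofReal_norm, intervalIntegral.norm_intervalIntegral_eq]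
        _ ≤ ∫⁻ x in Set.uIoc r s, ‖g' x‖ₑ := enorm_integral_le_lintegral_enorm _
        _ ≤ M := lintegral_mono_set
            (Set.uIoc_subset_uIcc.trans (Set.uIcc_subset_Icc hr hs))
    calc ‖g s‖ₑ = ‖g r + (g s - g r)‖ₑ := by congr 1; ring
      _ ≤ ‖g r‖ₑ + ‖g s - g r‖ₑ := enorm_add_le _ _
      _ ≤ _ := by gcongr
  -- averaging over `r ∈ [0, 1]`, an interval of length one inside `[-1, 1]`
  calc ‖g s‖ₑ = ∫⁻ _ in Set.Icc (0 : ℝ) 1, ‖g s‖ₑ := by simp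
    _ ≤ ∫⁻ r in Set.Icc (0 : ℝ) 1, (‖g r‖ₑ + M) := setLIntegral_mono' measurableSet_Icc
        fun r hr => h1 r ⟨by linarith [hr.1], hr.2⟩
    _ = (∫⁻ r in Set.Icc (0 : ℝ) 1, ‖g r‖ₑ) + M := by
        rw [lintegral_add_left hgc.enorm.measurable]; simp
    _ ≤ (∫⁻ r in Set.Icc (-1 : ℝ) 1, ‖g r‖ₑ) + M := by
        gcongr
        norm_num
    _ = _ := by rw [lintegral_add_left hgc.enorm.measurable]

/-- The size of a function and of its spherical gradient, as a density for the `W^{1,1}` norm. -/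
noncomputable def sobolevDensity (f : E3 → ℝ) (x : S2) : ENNReal := ‖f x‖ₑ + ‖sphGrad f x‖ₑ

theorem measurable_sobolevDensity {f : E3 → ℝ} (hf : ContDiff ℝ ∞ f) :
    Measurable (sobolevDensity f) :=
  (((hf.continuous.comp continuous_subtype_val).enorm).add
    hf.continuous_sphGrad.enorm).measurable

theorem enorm_deriv_le {f : E3 → ℝ} (s t : ℝ) (e : E3) (he : ‖e‖ = 1) :
    ‖‖facePoint s t‖⁻¹ * inner ℝ (sphGrad f (faceChart s t)) e‖ₑ
      ≤ ‖sphGrad f (faceChart s t)‖ₑ := by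
  rw [← ofReal_norm, ← ofReal_norm]
  refine ENNReal.ofReal_le_ofReal ?_
  rw [norm_mul, norm_inv, norm_norm]
  have h1 : ‖facePoint s t‖⁻¹ ≤ 1 := inv_le_one_of_one_le₀ (one_le_norm_facePoint s t)
  have h2 := norm_inner_le_norm (𝕜 := ℝ) (sphGrad f (faceChart s t)) e
  rw [he, mul_one] at h2
  calc _ ≤ 1 * ‖sphGrad f (faceChart s t)‖ := by gcongr
    _ = _ := one_mul _

theorem continuous_radial_deriv {f : E3 → ℝ} (hf : ContDiff ℝ ∞ f) (e : E3) :
    Continuous fun p : ℝ × ℝ =>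
      ‖facePoint p.1 p.2‖⁻¹ * inner ℝ (sphGrad f (faceChart p.1 p.2)) e := by
  have h1 := continuous_facePoint
  have h2 := hf.continuous_sphGrad.comp continuous_faceChart
  refine (Continuous.inv₀ h1.norm fun p => ?_).mul (h2.inner continuous_const)
  have := one_le_norm_facePoint p.1 p.2
  linarith

theorem enorm_le_left {f : E3 → ℝ} (hf : ContDiff ℝ ∞ f) {s : ℝ} (hs : s ∈ Set.Icc (-1 : ℝ) 1)
    (t : ℝ) : ‖f (faceChart s t)‖ₑ
      ≤ ∫⁻ r in Set.Icc (-1 : ℝ) 1, sobolevDensity f (faceChart r t) := by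
  have hd (s : ℝ) : HasDerivAt (fun s => f (faceChart s t)) (‖facePoint s t‖⁻¹ *
      inner ℝ (sphGrad f (faceChart s t)) (EuclideanSpace.single 0 1)) s :=
    hasDerivAt_comp_normalize hf (hasDerivAt_facePoint_left s t)
      (norm_pos_iff.1 (zero_lt_one.trans_le (one_le_norm_facePoint s t))) (faceChart s t) rfl
  have hpair : Continuous fun s : ℝ => ((s, t) : ℝ × ℝ) := by fun_prop
  have hc : Continuous ((fun p : ℝ × ℝ => ‖facePoint p.1 p.2‖⁻¹ *
      inner ℝ (sphGrad f (faceChart p.1 p.2)) (EuclideanSpace.single 0 1)) ∘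
      fun s : ℝ => ((s, t) : ℝ × ℝ)) := (continuous_radial_deriv hf _).comp hpair
  refine (enorm_le_lintegral_add_deriv hd hc hs).trans ?_
  refine lintegral_mono fun r => ?_
  exact add_le_add le_rfl (enorm_deriv_le r t _ (by simp))

theorem enorm_le_right {f : E3 → ℝ} (hf : ContDiff ℝ ∞ f) (s : ℝ) {t : ℝ}
    (ht : t ∈ Set.Icc (-1 : ℝ) 1) : ‖f (faceChart s t)‖ₑ
      ≤ ∫⁻ r in Set.Icc (-1 : ℝ) 1, sobolevDensity f (faceChart s r) := by
  have hd (t : ℝ) : HasDerivAt (fun t => f (faceChart s t)) (‖facePoint s t‖⁻¹ *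
      inner ℝ (sphGrad f (faceChart s t)) (EuclideanSpace.single 1 1)) t :=
    hasDerivAt_comp_normalize hf (hasDerivAt_facePoint_right s t)
      (norm_pos_iff.1 (zero_lt_one.trans_le (one_le_norm_facePoint s t))) (faceChart s t) rfl
  have hpair : Continuous fun t : ℝ => ((s, t) : ℝ × ℝ) := by fun_prop
  have hc : Continuous ((fun p : ℝ × ℝ => ‖facePoint p.1 p.2‖⁻¹ *
      inner ℝ (sphGrad f (faceChart p.1 p.2)) (EuclideanSpace.single 1 1)) ∘
      fun t : ℝ => ((s, t) : ℝ × ℝ)) := (continuous_radial_deriv hf _).comp hpair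
  refine (enorm_le_lintegral_add_deriv hd hc ht).trans ?_
  refine lintegral_mono fun r => ?_
  exact add_le_add le_rfl (enorm_deriv_le s r _ (by simp))

/-- The Sobolev inequality on the face: `|f|²` is bounded by the product of a function of `s` and a
function of `t`, whose integrals are both the `W^{1,1}` norm. -/
theorem faceIntegral_sq_le {f : E3 → ℝ} (hf : ContDiff ℝ ∞ f) :
    faceIntegral (fun x => ‖f x‖ₑ ^ 2) ≤ faceIntegral (sobolevDensity f) ^ 2 := by
  have hm : Measurable fun p : ℝ × ℝ => sobolevDensity f (faceChart p.1 p.2) :=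
    (measurable_sobolevDensity hf).comp continuous_faceChart.measurable
  have hA : Measurable fun t => ∫⁻ r in Set.Icc (-1 : ℝ) 1, sobolevDensity f (faceChart r t) :=
    hm.lintegral_prod_left'
  have hB : Measurable fun s => ∫⁻ r in Set.Icc (-1 : ℝ) 1, sobolevDensity f (faceChart s r) :=
    hm.lintegral_prod_right'
  calc faceIntegral (fun x => ‖f x‖ₑ ^ 2)
      ≤ ∫⁻ s in Set.Icc (-1 : ℝ) 1, ∫⁻ t in Set.Icc (-1 : ℝ) 1,
          (∫⁻ r in Set.Icc (-1 : ℝ) 1, sobolevDensity f (faceChart s r)) *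
          (∫⁻ r in Set.Icc (-1 : ℝ) 1, sobolevDensity f (faceChart r t)) := by
        refine setLIntegral_mono' measurableSet_Icc fun s hs =>
          setLIntegral_mono' measurableSet_Icc fun t ht => ?_
        change ‖f (faceChart s t)‖ₑ ^ 2 ≤ _
        rw [sq]
        exact mul_le_mul' (enorm_le_right hf s ht) (enorm_le_left hf hs t)
    _ = faceIntegral (sobolevDensity f) ^ 2 := by
        simp only [lintegral_const_mul _ hA]
        rw [lintegral_mul_const _ hB, sq]
        congr 1
        rw [faceIntegral, lintegral_lintegral_swap]
        exact (hm.comp measurable_swap).aemeasurable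

theorem setLIntegral_faceSet_sq_le {f : E3 → ℝ} (hf : ContDiff ℝ ∞ f) :
    ∫⁻ x in faceSet, ‖f x‖ₑ ^ 2 ∂(volume : Measure E3).toSphere
      ≤ 36 * (∫⁻ x, sobolevDensity f x ∂(volume : Measure E3).toSphere) ^ 2 := by
  have hm : Measurable fun x : S2 => ‖f x‖ₑ ^ 2 :=
    ((hf.continuous.comp continuous_subtype_val).enorm.measurable).pow_const 2
  calc _ ≤ _ := setLIntegral_faceSet_le hm
    _ ≤ _ := faceIntegral_sq_le hf
    _ ≤ (6 * ∫⁻ x, sobolevDensity f x ∂(volume : Measure E3).toSphere) ^ 2 := by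
        gcongr
        exact (faceIntegral_le (measurable_sobolevDensity hf)).trans
          (by gcongr; exact Measure.restrict_le_self)
    _ = _ := by rw [mul_pow]; norm_num

theorem sphGrad_comp_isometry {f : E3 → ℝ} (hf : ContDiff ℝ ∞ f) (R : E3 ≃ₗᵢ[ℝ] E3) (x : S2) :
    sphGrad (fun y => f (R y)) x = R.symm (sphGrad f (sphMap R x)) := by
  have hg : gradient (fun y => f (R y)) (x : E3) = R.symm (gradient f (R x)) := by
    refine ext_inner_right ℝ fun w => ?_
    rw [gradient, InnerProductSpace.toDual_symm_apply, R.symm.inner_map_eq_flip, gradient]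
    simp only [LinearIsometryEquiv.symm_symm, InnerProductSpace.toDual_symm_apply]
    have h1 := (hf.differentiable (by simp) (R x)).hasFDerivAt
    have h2 : HasFDerivAt (fun y => R y) (R : E3 →L[ℝ] E3) (x : E3) :=
      (R : E3 →L[ℝ] E3).hasFDerivAt
    have h3 : HasFDerivAt (fun y => f (R y)) _ (x : E3) := h1.comp (x : E3) h2
    rw [h3.fderiv]
    rfl
  rw [sphGrad, sphGrad, hg, map_sub, map_smul, coe_sphMap, R.symm_apply_apply,
    R.symm.inner_map_eq_flip, R.symm_symm]

theorem setLIntegral_preimage_faceSet_sq_le {f : E3 → ℝ} (hf : ContDiff ℝ ∞ f)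
    (R : E3 ≃ₗᵢ[ℝ] E3) :
    ∫⁻ x in sphMap R ⁻¹' faceSet, ‖f x‖ₑ ^ 2 ∂(volume : Measure E3).toSphere
      ≤ 36 * (∫⁻ x, sobolevDensity f x ∂(volume : Measure E3).toSphere) ^ 2 := by
  have hm : Measurable fun x : S2 => ‖f x‖ₑ ^ 2 :=
    ((hf.continuous.comp continuous_subtype_val).enorm.measurable).pow_const 2
  have hmp := measurePreserving_sphMap_toSphere R
  have hf' : ContDiff ℝ ∞ fun y => f (R.symm y) :=
    hf.comp (R.symm : E3 →L[ℝ] E3).contDiff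
  have h := setLIntegral_faceSet_sq_le hf'
  have hm' : Measurable fun x : S2 => ‖f (R.symm x)‖ₑ ^ 2 :=
    ((hf'.continuous.comp continuous_subtype_val).enorm.measurable).pow_const 2
  rw [← hmp.setLIntegral_comp_preimage measurableSet_faceSet hm',
    ← hmp.lintegral_comp (measurable_sobolevDensity hf')] at h
  convert h using 3
  · simp
  · refine lintegral_congr fun x => ?_
    rw [sobolevDensity, sobolevDensity, sphGrad_comp_isometry hf]
    have : sphMap R.symm (sphMap R x) = x := Subtype.ext (by simp)
    rw [this]
    simp [← ofReal_norm]

/-- The six faces of the cube cover the sphere. -/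
theorem exists_isometries_cover : ∃ R : Fin 3 × Bool → (E3 ≃ₗᵢ[ℝ] E3),
    ∀ x : S2, ∃ i, x ∈ sphMap (R i) ⁻¹' faceSet := by
  let P (i : Fin 3) : E3 ≃ₗᵢ[ℝ] E3 := LinearIsometryEquiv.piLpCongrLeft 2 ℝ ℝ (Equiv.swap i 2)
  refine ⟨fun i => if i.2 then P i.1 else (P i.1).trans (LinearIsometryEquiv.neg ℝ), fun x => ?_⟩
  obtain ⟨i, hi⟩ := Finite.exists_max fun i => |(x : E3) i|
  have hP (j : Fin 3) : P i (x : E3) j = (x : E3) (Equiv.swap i 2 j) := by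
    simp [P, LinearIsometryEquiv.piLpCongrLeft_apply, Equiv.piCongrLeft'_apply]
  rcases le_total 0 ((x : E3) i) with h | h
  · refine ⟨(i, true), ?_⟩
    rw [abs_of_nonneg h] at hi
    simp [faceSet, hP, hi]
  · refine ⟨(i, false), ?_⟩
    rw [abs_of_nonpos h] at hi
    simp [faceSet, hP, hi]

theorem lintegral_toSphere_sq_le {f : E3 → ℝ} (hf : ContDiff ℝ ∞ f) :
    ∫⁻ x : S2, ‖f x‖ₑ ^ 2 ∂(volume : Measure E3).toSphere
      ≤ 216 * (∫⁻ x, sobolevDensity f x ∂(volume : Measure E3).toSphere) ^ 2 := by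
  obtain ⟨R, hR⟩ := exists_isometries_cover
  have hU : (⋃ i, sphMap (R i) ⁻¹' faceSet) = Set.univ :=
    Set.eq_univ_of_forall fun x => Set.mem_iUnion.2 (hR x)
  rw [← setLIntegral_univ, ← hU]
  refine (lintegral_iUnion_le _ _).trans ?_
  rw [tsum_fintype]
  refine (Finset.sum_le_sum fun i _ => setLIntegral_preimage_faceSet_sq_le hf (R i)).trans ?_
  simp only [Finset.sum_const, Finset.card_univ, Fintype.card_prod, Fintype.card_fin,
    Fintype.card_bool, nsmul_eq_mul, ← mul_assoc]
  gcongr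
  norm_num

/-- The Sobolev inequality `W^{1,1} → L²` on the sphere. -/
theorem exists_sobolev : ∃ K : ℝ, 0 < K ∧ ∀ f : E3 → ℝ, ContDiff ℝ ∞ f →
    ∫ x : S2, f x ^ 2 ∂dω ≤ (K * ∫ x : S2, (|f x| + ‖sphGrad f x‖) ∂dω) ^ 2 := by
  set σ := (volume : Measure E3).toSphere with hσ
  set c := (σ Set.univ).toReal with hc
  have hc0 : 0 < c := ENNReal.toReal_pos
    (by rw [Measure.measure_univ_ne_zero]; exact Measure.toSphere_ne_zero _) (measure_ne_top _ _)
  refine ⟨√(216 * c), by positivity, fun f hf => ?_⟩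
  have hfc : Continuous fun x : S2 => f x := hf.continuous.comp continuous_subtype_val
  have hdω : dω = (σ Set.univ)⁻¹ • σ := rfl
  have e1 : ∫ x : S2, f x ^ 2 ∂dω = c⁻¹ * (∫⁻ x : S2, ‖f x‖ₑ ^ 2 ∂σ).toReal := by
    rw [hdω, integral_smul_measure, ENNReal.toReal_inv, smul_eq_mul]
    congr 1
    rw [integral_eq_lintegral_of_nonneg_ae (.of_forall fun x => sq_nonneg _)
      (hfc.pow 2).aestronglyMeasurable]
    congr 1
    refine lintegral_congr fun x => ?_
    rw [← ofReal_norm, ← ENNReal.ofReal_pow (norm_nonneg _), Real.norm_eq_abs, sq_abs]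
  have e2 : ∫ x : S2, (|f x| + ‖sphGrad f x‖) ∂dω
      = c⁻¹ * (∫⁻ x : S2, sobolevDensity f x ∂σ).toReal := by
    rw [hdω, integral_smul_measure, ENNReal.toReal_inv, smul_eq_mul]
    congr 1
    have hc : Continuous fun x : S2 => |f x| + ‖sphGrad f x‖ :=
      hfc.abs.add hf.continuous_sphGrad.norm
    rw [integral_eq_lintegral_of_nonneg_ae
      (.of_forall fun x => add_nonneg (abs_nonneg _) (norm_nonneg _)) hc.aestronglyMeasurable]
    congr 1
    refine lintegral_congr fun x => ?_
    rw [sobolevDensity, ← ofReal_norm, ← ofReal_norm, ← ENNReal.ofReal_add (by simp) (by simp)]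
    rfl
  have hfin : ∫⁻ x : S2, sobolevDensity f x ∂σ ≠ ⊤ := by
    have h : Integrable (fun x : S2 => |f x| + ‖sphGrad f x‖) σ :=
      (hfc.abs.add hf.continuous_sphGrad.norm).integrable_of_hasCompactSupport
        (HasCompactSupport.of_compactSpace _)
    refine ((lintegral_mono fun x => ?_).trans_lt h.2).ne
    rw [sobolevDensity, ← ofReal_norm, ← ofReal_norm, ← ofReal_norm,
      ← ENNReal.ofReal_add (norm_nonneg _) (norm_nonneg _)]
    exact ENNReal.ofReal_le_ofReal (le_abs_self _)
  have h := ENNReal.toReal_mono (by finiteness) (lintegral_toSphere_sq_le hf)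
  rw [ENNReal.toReal_mul, ENNReal.toReal_pow, ENNReal.toReal_ofNat, ← hσ] at h
  rw [e1, e2, mul_pow, Real.sq_sqrt (by positivity), mul_pow]
  calc _ ≤ c⁻¹ * (216 * (∫⁻ x : S2, sobolevDensity f x ∂σ).toReal ^ 2) := by gcongr
    _ = _ := by field_simp

/-! ### Exponential integrability -/

theorem sq_integral_mul_le {u v : S2 → ℝ} (hu : Continuous u) (hv : Continuous v) :
    (∫ x, u x * v x ∂dω) ^ 2 ≤ (∫ x, u x ^ 2 ∂dω) * ∫ x, v x ^ 2 ∂dω := by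
  have h (u v : S2 → ℝ) (hu : Continuous u) (hv : Continuous v) :
      inner ℝ ((hu.memLp_sphere 2).toLp u) ((hv.memLp_sphere 2).toLp v) = ∫ x, u x * v x ∂dω := by
    rw [L2.inner_def]
    refine integral_congr_ae ?_
    filter_upwards [(hu.memLp_sphere 2).coeFn_toLp, (hv.memLp_sphere 2).coeFn_toLp] with x h1 h2
    rw [h1, h2]
    simp [mul_comm]
  have := real_inner_mul_inner_self_le ((hu.memLp_sphere 2).toLp u) ((hv.memLp_sphere 2).toLp v)
  simp only [h _ _ hu hv, h _ _ hu hu, h _ _ hv hv] at this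
  simpa only [sq] using this

theorem sphGrad_pow {f : E3 → ℝ} (hf : ContDiff ℝ ∞ f) (k : ℕ) (x : S2) :
    sphGrad (fun y => f y ^ (k + 1)) x = ((k + 1) * f x ^ k) • sphGrad f x := by
  have hg : gradient (fun y => f y ^ (k + 1)) (x : E3) = ((k + 1) * f x ^ k) • gradient f x := by
    rw [gradient, gradient, ← map_smul]
    congr 1
    have := (hf.differentiable (by simp) (x : E3)).hasFDerivAt.pow (k + 1)
    simpa using this.fderiv
  rw [sphGrad, sphGrad, hg, inner_smul_left, smul_sub, smul_smul]
  simp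

/-- Moment bounds of a smooth function, obtained by applying the Sobolev inequality to its
powers. -/
theorem moment_le {K : ℝ} (hK0 : 0 < K) (hK : ∀ f : E3 → ℝ, ContDiff ℝ ∞ f →
      ∫ x : S2, f x ^ 2 ∂dω ≤ (K * ∫ x : S2, (|f x| + ‖sphGrad f x‖) ∂dω) ^ 2)
    {f : E3 → ℝ} (hf : ContDiff ℝ ∞ f) (k : ℕ) :
    ∫ x : S2, f x ^ (2 * k) ∂dω
      ≤ (K ^ 2 * ∫ x : S2, (|f x| + ‖sphGrad f x‖) ^ 2 ∂dω) ^ k * (k.factorial : ℝ) ^ 2 := by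
  have hfc : Continuous fun x : S2 => f x := hf.continuous.comp continuous_subtype_val
  have hwc : Continuous fun x : S2 => |f x| + ‖sphGrad f x‖ :=
    hfc.abs.add hf.continuous_sphGrad.norm
  set S := ∫ x : S2, (|f x| + ‖sphGrad f x‖) ^ 2 ∂dω with hS
  have hS0 : 0 ≤ S := integral_nonneg fun x => sq_nonneg _
  induction k with
  | zero => simp
  | succ k ih =>
    have h1 := hK (fun y => f y ^ (k + 1)) (hf.pow _)
    have h2 : ∫ x : S2, (|f x ^ (k + 1)| + ‖sphGrad (fun y => f y ^ (k + 1)) x‖) ∂dω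
        ≤ (k + 1) * ∫ x : S2, |f x| ^ k * (|f x| + ‖sphGrad f x‖) ∂dω := by
      rw [← integral_const_mul]
      refine integral_mono ?_ ?_ fun x => ?_
      · exact Continuous.integrable_sphere (((hfc.pow _).abs).add
          (hf.pow (k + 1)).continuous_sphGrad.norm)
      · exact Continuous.integrable_sphere (((hfc.abs.pow _).mul hwc).const_mul _)
      · simp only [sphGrad_pow hf, norm_smul, abs_pow, norm_mul, norm_pow, Real.norm_eq_abs]
        rw [abs_of_nonneg (by positivity : (0 : ℝ) ≤ (k : ℝ) + 1), pow_succ]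
        have : 0 ≤ (k : ℝ) * (|f x| ^ k * |f x|) := by positivity
        linarith
    have h3 : 0 ≤ ∫ x : S2, (|f x ^ (k + 1)| + ‖sphGrad (fun y => f y ^ (k + 1)) x‖) ∂dω :=
      integral_nonneg fun x => add_nonneg (abs_nonneg _) (norm_nonneg _)
    have h4 : (∫ x : S2, |f x| ^ k * (|f x| + ‖sphGrad f x‖) ∂dω) ^ 2
        ≤ (∫ x : S2, (|f x| ^ k) ^ 2 ∂dω) * S := sq_integral_mul_le (hfc.abs.pow k) hwc
    have h5 (x : S2) : (|f x| ^ k) ^ 2 = f x ^ (2 * k) := by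
      rw [← pow_mul, mul_comm k 2, pow_mul, sq_abs, pow_mul]
    simp only [h5] at h4
    calc ∫ x : S2, f x ^ (2 * (k + 1)) ∂dω = ∫ x : S2, (f x ^ (k + 1)) ^ 2 ∂dω := by
          simp only [← pow_mul, mul_comm]
      _ ≤ _ := h1
      _ ≤ (K * ((k + 1) * ∫ x : S2, |f x| ^ k * (|f x| + ‖sphGrad f x‖) ∂dω)) ^ 2 := by
          gcongr
      _ = K ^ 2 * (k + 1) ^ 2 * (∫ x : S2, |f x| ^ k * (|f x| + ‖sphGrad f x‖) ∂dω) ^ 2 := by ring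
      _ ≤ K ^ 2 * (k + 1) ^ 2 * ((∫ x : S2, f x ^ (2 * k) ∂dω) * S) := by gcongr
      _ ≤ K ^ 2 * (k + 1) ^ 2 * (((K ^ 2 * S) ^ k * (k.factorial : ℝ) ^ 2) * S) := by gcongr
      _ = _ := by rw [Nat.factorial_succ]; push_cast; ring

/-- A weak Trudinger inequality for smooth functions of small energy. -/
theorem exists_lintegral_cosh_le : ∃ κ : ℝ, 0 < κ ∧ ∀ f : E3 → ℝ, ContDiff ℝ ∞ f → ∀ c : ℝ,
    c ^ 2 * (∫ x : S2, f x ^ 2 ∂dω + ∫ x : S2, ‖sphGrad f x‖ ^ 2 ∂dω) ≤ κ →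
    ∫⁻ x : S2, ENNReal.ofReal (Real.cosh (c * f x)) ∂dω ≤ 2 := by
  obtain ⟨K, hK0, hK⟩ := exists_sobolev
  -- with this bound the moments make the series of `cosh` geometric of ratio `1 / 2`
  refine ⟨1 / (4 * K ^ 2), by positivity, fun f hf c hc => ?_⟩
  have hfc : Continuous fun x : S2 => f x := hf.continuous.comp continuous_subtype_val
  set S := ∫ x : S2, (|f x| + ‖sphGrad f x‖) ^ 2 ∂dω with hS
  have hS0 : 0 ≤ S := integral_nonneg fun x => sq_nonneg _
  have hS2 : S ≤ 2 * (∫ x : S2, f x ^ 2 ∂dω + ∫ x : S2, ‖sphGrad f x‖ ^ 2 ∂dω) := by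
    have i1 : Integrable (fun x : S2 => f x ^ 2) dω := Continuous.integrable_sphere (hfc.pow 2)
    have i2 : Integrable (fun x : S2 => ‖sphGrad f x‖ ^ 2) dω :=
      Continuous.integrable_sphere (hf.continuous_sphGrad.norm.pow 2)
    rw [← integral_add i1 i2, ← integral_const_mul]
    refine integral_mono ?_ ?_ fun x => ?_
    · exact Continuous.integrable_sphere ((hfc.abs.add hf.continuous_sphGrad.norm).pow 2)
    · exact Continuous.integrable_sphere
        (((hfc.pow 2).add (hf.continuous_sphGrad.norm.pow 2)).const_mul _)
    · have := sq_abs (f x)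
      simp only
      nlinarith [sq_nonneg (|f x| - ‖sphGrad f x‖)]
  have hq : c ^ 2 * (K ^ 2 * S) ≤ 1 / 2 := by
    rw [le_div_iff₀ (by positivity)] at hc
    have := mul_le_mul_of_nonneg_left hS2 (by positivity : 0 ≤ c ^ 2 * K ^ 2)
    nlinarith
  have hsum (y : ℝ) : ENNReal.ofReal (Real.cosh y)
      = ∑' n : ℕ, ENNReal.ofReal (y ^ (2 * n) / (2 * n).factorial) := by
    have h := Real.hasSum_cosh y
    have h0 (n : ℕ) : 0 ≤ y ^ (2 * n) / (2 * n).factorial := by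
      rw [pow_mul]; positivity
    rw [← h.tsum_eq, ENNReal.ofReal_tsum_of_nonneg h0 h.summable]
  simp only [hsum]
  rw [lintegral_tsum]
  · calc ∑' n : ℕ, ∫⁻ x : S2, ENNReal.ofReal ((c * f x) ^ (2 * n) / (2 * n).factorial) ∂dω
        ≤ ∑' n : ℕ, (2⁻¹ : ENNReal) ^ n := by
          refine ENNReal.tsum_le_tsum fun n => ?_
          rw [← ofReal_integral_eq_lintegral_ofReal]
          · have e : (2⁻¹ : ENNReal) ^ n = ENNReal.ofReal ((1 / 2) ^ n) := by
              rw [ENNReal.ofReal_pow (by norm_num), one_div, ENNReal.ofReal_inv_of_pos (by norm_num)]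
              simp
            rw [e]
            refine ENNReal.ofReal_le_ofReal ?_
            simp only [mul_pow, mul_div_assoc]
            rw [integral_const_mul, integral_div]
            have h1 := moment_le hK0 hK hf n
            have h2 : (n.factorial : ℝ) ^ 2 ≤ (2 * n).factorial := by
              rw [sq, two_mul]
              exact_mod_cast Nat.le_of_dvd (Nat.factorial_pos _)
                (Nat.factorial_mul_factorial_dvd_factorial_add n n)
            calc c ^ (2 * n) * ((∫ x : S2, f x ^ (2 * n) ∂dω) / (2 * n).factorial)
                ≤ c ^ (2 * n) * (((K ^ 2 * S) ^ n * (n.factorial : ℝ) ^ 2) / (2 * n).factorial) := by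
                  have : 0 ≤ c ^ (2 * n) := by rw [pow_mul]; positivity
                  gcongr
              _ = (c ^ 2 * (K ^ 2 * S)) ^ n * ((n.factorial : ℝ) ^ 2 / (2 * n).factorial) := by
                  rw [pow_mul, mul_pow (c ^ 2)]; ring
              _ ≤ (1 / 2) ^ n * 1 := by
                  gcongr
                  exact div_le_one_of_le₀ h2 (by positivity)
              _ = _ := mul_one _
          · exact Continuous.integrable_sphere (((hfc.const_mul c).pow _).div_const _)
          · refine .of_forall fun x => ?_
            simp only [Pi.zero_apply]
            rw [pow_mul]
            positivity
      _ = 2 := by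
          rw [ENNReal.tsum_geometric, ENNReal.one_sub_inv_two, inv_inv]
  · intro n
    exact ((((hfc.const_mul c).pow (2 * n)).div_const _).measurable.ennreal_ofReal).aemeasurable

theorem norm_sq_eq_integral {F : Type*} [NormedAddCommGroup F] [InnerProductSpace ℝ F]
    (u : Lp F 2 dω) : ‖u‖ ^ 2 = ∫ x, ‖u x‖ ^ 2 ∂dω := by
  rw [← real_inner_self_eq_norm_sq, L2.inner_def]
  simp only [real_inner_self_eq_norm_sq]

open Filter Topology in
/-- The weak Trudinger inequality passes to `H¹` by Fatou's lemma. -/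
theorem H1.exists_lintegral_cosh_le : ∃ κ : ℝ, 0 < κ ∧ ∀ (g : H1) (c : ℝ),
    c ^ 2 * (‖g.1.1‖ ^ 2 + ‖g.1.2‖ ^ 2) < κ →
    ∫⁻ x : S2, ENNReal.ofReal (Real.cosh (c * g.val x)) ∂dω ≤ 2 := by
  obtain ⟨κ, hκ, h⟩ := _root_.exists_lintegral_cosh_le
  refine ⟨κ, hκ, fun g c hg => ?_⟩
  obtain ⟨p, hp, hlim⟩ := mem_closure_iff_seq_limit.1 g.2
  have hlim1 : Tendsto (fun n => (p n).1) atTop (𝓝 g.1.1) :=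
    (continuous_fst.tendsto _).comp hlim
  have hev : ∀ᶠ n in atTop, c ^ 2 * (‖(p n).1‖ ^ 2 + ‖(p n).2‖ ^ 2) < κ := by
    have hc : Continuous fun q : Lp ℝ 2 dω × Lp E3 2 dω => c ^ 2 * (‖q.1‖ ^ 2 + ‖q.2‖ ^ 2) := by
      fun_prop
    exact ((hc.tendsto _).comp hlim).eventually_lt_const hg
  obtain ⟨ns, hns, hae⟩ := (tendstoInMeasure_of_tendsto_Lp hlim1).exists_seq_tendsto_ae
  have hbound : ∀ᶠ n in atTop,
      ∫⁻ x, ENNReal.ofReal (Real.cosh (c * (p (ns n)).1 x)) ∂dω ≤ 2 := by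
    filter_upwards [hns.tendsto_atTop.eventually hev] with n hn
    obtain ⟨f, hf, hf1, hf2⟩ := hp (ns n)
    have e1 : ‖(p (ns n)).1‖ ^ 2 = ∫ x : S2, f x ^ 2 ∂dω := by
      rw [norm_sq_eq_integral]
      refine integral_congr_ae ?_
      filter_upwards [hf1] with x hx
      rw [hx, Real.norm_eq_abs, sq_abs]
    have e2 : ‖(p (ns n)).2‖ ^ 2 = ∫ x : S2, ‖sphGrad f x‖ ^ 2 ∂dω := by
      rw [norm_sq_eq_integral]
      refine integral_congr_ae ?_
      filter_upwards [hf2] with x hx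
      rw [hx]
    rw [e1, e2] at hn
    refine le_trans (le_of_eq ?_) (h f hf c hn.le)
    refine lintegral_congr_ae ?_
    filter_upwards [hf1] with x hx
    rw [hx]
  calc ∫⁻ x : S2, ENNReal.ofReal (Real.cosh (c * g.val x)) ∂dω
      = ∫⁻ x, liminf (fun n => ENNReal.ofReal (Real.cosh (c * (p (ns n)).1 x))) atTop ∂dω := by
        refine lintegral_congr_ae ?_
        filter_upwards [hae] with x hx
        refine Eq.symm (Tendsto.liminf_eq ?_)
        have hc : Continuous fun y : ℝ => ENNReal.ofReal (Real.cosh (c * y)) :=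
          ENNReal.continuous_ofReal.comp (Real.continuous_cosh.comp (continuous_const_mul c))
        exact (hc.tendsto _).comp hx
    _ ≤ liminf (fun n => ∫⁻ x, ENNReal.ofReal (Real.cosh (c * (p (ns n)).1 x)) ∂dω) atTop := by
        refine lintegral_liminf_le' fun n => ?_
        have hc : Measurable fun y : ℝ => ENNReal.ofReal (Real.cosh (c * y)) := by
          have := Real.continuous_cosh
          fun_prop
        exact hc.comp_aemeasurable (Lp.aestronglyMeasurable _).aemeasurable
    _ ≤ 2 := liminf_le_of_le (by isBoundedDefault) fun b hb => by
        obtain ⟨n, h1, h2⟩ := (hb.and hbound).exists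
        exact h1.trans h2

/-- Exponential integrability of `H¹` functions: a function in `H¹` is the sum of a bounded function
and of a function of small energy. -/
theorem H1.integrable_exp (u : H1) (c : ℝ) :
    Integrable (fun x => Real.exp (c * u.val x)) dω := by
  obtain ⟨κ, hκ, h⟩ := H1.exists_lintegral_cosh_le
  have hmeas : AEStronglyMeasurable (fun x => Real.exp (c * u.val x)) dω :=
    (by fun_prop : Continuous fun y : ℝ => Real.exp (c * y)).comp_aestronglyMeasurable u.memLp_val.1
  obtain ⟨p, hp, hpc⟩ : ∃ p ∈ (smoothGraph : Set (Lp ℝ 2 dω × Lp E3 2 dω)),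
      c ^ 2 * (‖u.1.1 - p.1‖ ^ 2 + ‖u.1.2 - p.2‖ ^ 2) < κ := by
    have hc : Continuous fun q : Lp ℝ 2 dω × Lp E3 2 dω =>
        c ^ 2 * (‖u.1.1 - q.1‖ ^ 2 + ‖u.1.2 - q.2‖ ^ 2) := by fun_prop
    obtain ⟨p, hp1, hp2⟩ := mem_closure_iff.1 u.2 _ (isOpen_lt hc continuous_const)
      (show c ^ 2 * (‖u.1.1 - u.1.1‖ ^ 2 + ‖u.1.2 - u.1.2‖ ^ 2) < κ by simpa using hκ)
    exact ⟨p, hp2, hp1⟩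
  set g : H1 := u - ⟨p, subset_closure hp⟩ with hg
  have hgc := h g c hpc
  obtain ⟨f, hf, hf1, -⟩ := id hp
  have hfc : Continuous fun x : S2 => f x := hf.continuous.comp continuous_subtype_val
  obtain ⟨B, hB⟩ := (isCompact_range hfc).isBounded.exists_norm_le
  have hgv : g.val =ᵐ[dω] fun x => u.val x - f x := by
    filter_upwards [Lp.coeFn_sub u.1.1 p.1, hf1] with x h1 h2
    rw [← h2]
    exact h1
  have hgi : Integrable (fun x => Real.cosh (c * g.val x)) dω := by
    refine ⟨Real.continuous_cosh.comp_aestronglyMeasurable (g.memLp_val.1.const_mul c), ?_⟩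
    rw [hasFiniteIntegral_iff_ofReal (.of_forall fun x => (Real.cosh_pos _).le)]
    exact hgc.trans_lt (by simp)
  refine (hgi.const_mul (2 * Real.exp (|c| * B))).mono' hmeas ?_
  filter_upwards [hgv] with x hx
  have e1 : c * u.val x = c * f x + c * g.val x := by rw [hx]; ring
  have e2 : Real.exp (c * f x) ≤ Real.exp (|c| * B) := by
    refine Real.exp_le_exp.2 ((le_abs_self _).trans ?_)
    rw [abs_mul]
    gcongr
    exact hB _ ⟨x, rfl⟩
  have e3 : Real.exp (c * g.val x) ≤ 2 * Real.cosh (c * g.val x) := by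
    rw [Real.cosh_eq]
    linarith [Real.exp_pos (-(c * g.val x))]
  rw [Real.norm_of_nonneg (Real.exp_pos _).le, e1, Real.exp_add]
  calc _ ≤ Real.exp (|c| * B) * (2 * Real.cosh (c * g.val x)) := by gcongr
    _ = _ := by ring

/-! ### Moments of the coordinates -/

/-- The derivative of a polynomial along a rotation field has mean zero; applied to monomials of
degree at most two, this determines the moments of the coordinates. -/
theorem integral_rotD (k : Fin 3) (p : MvPolynomial (Fin 3) ℝ) :
    ∫ x : S2, polyFun (rotD k p) x ∂dω = 0 := by
  simp only [polyFun_rotD]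
  exact integral_fderiv_skew (rotField_mem_skewAdjoint k) ((contDiff_polyFun p).of_le (by simp))

theorem continuous_coord (i : Fin 3) : Continuous fun x : S2 => (x : E3) i := by fun_prop

theorem integral_coord (i : Fin 3) : ∫ x : S2, (x : E3) i ∂dω = 0 := by
  have h (k : Fin 3) : ∫ x : S2, (x : E3) (k + 2) ∂dω = 0 := by
    have := integral_rotD k (.X (k + 1))
    have e : rotD k (.X (k + 1)) = -.X (k + 2) := by
      rw [rotD_apply, MvPolynomial.pderiv_X, MvPolynomial.pderiv_X]
      fin_cases k <;> simp
    rw [e] at this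
    simpa [integral_neg] using this
  have := h (i + 1)
  rwa [add_assoc, show (1 + 2 : Fin 3) = 0 from rfl, add_zero] at this

theorem integral_coord_mul (i j : Fin 3) :
    ∫ x : S2, (x : E3) i * (x : E3) j ∂dω = if i = j then 1 / 3 else 0 := by
  have hq (i : Fin 3) : Integrable (fun x : S2 => (x : E3) i ^ 2) dω :=
    Continuous.integrable_sphere ((continuous_coord i).pow 2)
  have h1 (k : Fin 3) : ∫ x : S2, (x : E3) k * (x : E3) (k + 2) ∂dω = 0 := by
    have := integral_rotD k (.X k * .X (k + 1))
    have e : rotD k (.X k * .X (k + 1)) = -(.X k * .X (k + 2)) := by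
      rw [Derivation.leibniz, rotD_apply, rotD_apply]
      simp only [MvPolynomial.pderiv_X]
      fin_cases k <;> simp
    rw [e] at this
    simpa [integral_neg] using this
  have h2 (k : Fin 3) : ∫ x : S2, (x : E3) (k + 1) ^ 2 ∂dω = ∫ x : S2, (x : E3) (k + 2) ^ 2 ∂dω := by
    have := integral_rotD k (.X (k + 1) * .X (k + 2))
    have e : rotD k (.X (k + 1) * .X (k + 2)) = .X (k + 1) * .X (k + 1) - .X (k + 2) * .X (k + 2) := by
      rw [Derivation.leibniz, rotD_apply, rotD_apply]
      simp only [MvPolynomial.pderiv_X]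
      fin_cases k <;> simp <;> ring
    rw [e] at this
    simp only [polyFun_sub, polyFun_mul, polyFun_X] at this
    simp only [← sq] at this
    rw [integral_sub (hq _) (hq _), sub_eq_zero] at this
    exact this
  have h3 : ∑ i : Fin 3, ∫ x : S2, (x : E3) i ^ 2 ∂dω = 1 := by
    rw [← integral_finsetSum _ fun i _ => hq i]
    simp [sum_sq_sphere]
  have h20 := h2 0
  have h21 := h2 1
  have h10 := h1 0
  have h11 := h1 1
  have h12 := h1 2
  simp only [Fin.sum_univ_three, Fin.isValue, Fin.reduceAdd] at h3 h20 h21 h10 h11 h12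
  have hc (i j : Fin 3) : ∫ x : S2, (x : E3) i * (x : E3) j ∂dω
      = ∫ x : S2, (x : E3) j * (x : E3) i ∂dω := by simp only [mul_comm]
  fin_cases i <;> fin_cases j <;> simp only [Fin.isValue, Fin.reduceFinMk, Fin.zero_eta,
    Fin.mk_one, ← sq, ↓reduceIte, Fin.reduceEq, one_ne_zero, zero_ne_one] <;>
    first | linarith | (rw [hc]; linarith)

/-! ### Positivity of the argument of the logarithm -/

theorem H1.aestronglyMeasurable_exp (u : H1) (c : ℝ) :
    AEStronglyMeasurable (fun x => Real.exp (c * u.val x)) dω := (u.integrable_exp c).1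

theorem MeasureTheory.Integrable.mul_continuous_sphere {g : S2 → ℝ} (hg : Integrable g dω) {w : S2 → ℝ}
    (hw : Continuous w) : Integrable (fun x => g x * w x) dω := by
  obtain ⟨C, hC⟩ := (isCompact_range hw).isBounded.exists_norm_le
  exact hg.mul_bdd hw.aestronglyMeasurable (.of_forall fun x => hC _ ⟨x, rfl⟩)

/-- The barycentre of the measure `e^{2u} dω` lies strictly inside the unit ball. -/
theorem expDet_pos (u : H1) : 0 < expDet u := by
  set e : S2 → ℝ := fun x => Real.exp (2 * u.val x) with he
  have hei : Integrable e dω := u.integrable_exp 2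
  have he0 (x : S2) : 0 < e x := Real.exp_pos _
  set b : E3 := WithLp.toLp 2 fun i => ∫ x, e x * (x : E3) i ∂dω with hb
  have hbi (i : Fin 3) : b i = ∫ x, e x * (x : E3) i ∂dω := rfl
  have ha : 0 < ∫ x, e x ∂dω := integral_exp_pos hei
  have hbx (x : S2) : inner ℝ b (x : E3) = ∑ i, b i * (x : E3) i := by
    simp [PiLp.inner_apply, mul_comm]
  have hbxc : Continuous fun x : S2 => inner ℝ b (x : E3) := by fun_prop
  have hnb : ‖b‖ ^ 2 = ∑ i, b i ^ 2 := by simp [EuclideanSpace.norm_sq_eq]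
  have h1 : ∫ x, e x * inner ℝ b (x : E3) ∂dω = ‖b‖ ^ 2 := by
    have : ∀ x : S2, e x * inner ℝ b (x : E3) = ∑ i, b i * (e x * (x : E3) i) := fun x => by
      rw [hbx, Finset.mul_sum]
      exact Finset.sum_congr rfl fun i _ => by ring
    simp only [this]
    rw [integral_finsetSum _ fun i _ => (hei.mul_continuous_sphere (continuous_coord i)).const_mul _,
      hnb]
    refine Finset.sum_congr rfl fun i _ => ?_
    rw [integral_const_mul, ← hbi, sq]
  have h2 : ∫ x : S2, inner ℝ b (x : E3) ∂dω = 0 := by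
    simp only [hbx]
    rw [integral_finsetSum _ fun i _ => ((continuous_coord i).integrable_sphere).const_mul _]
    simp [integral_const_mul, integral_coord]
  -- equality would force `⟨b, x⟩ = ‖b‖` almost everywhere, although `⟨b, x⟩` has mean zero
  have hlt : ‖b‖ < ∫ x, e x ∂dω := by
    by_cases hb0 : b = 0
    · simpa [hb0] using ha
    have hbp : 0 < ‖b‖ := norm_pos_iff.2 hb0
    have hnn (x : S2) : 0 ≤ ‖b‖ - inner ℝ b (x : E3) := by
      have := real_inner_le_norm b (x : E3)
      rw [norm_eq_of_mem_sphere, mul_one] at this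
      linarith
    have hgc : Continuous fun x : S2 => ‖b‖ - inner ℝ b (x : E3) := by fun_prop
    have hgi := hei.mul_continuous_sphere hgc
    have h3 : 0 < ∫ x, e x * (‖b‖ - inner ℝ b (x : E3)) ∂dω := by
      refine lt_of_le_of_ne (integral_nonneg fun x => mul_nonneg (he0 x).le (hnn x)) fun h => ?_
      have h4 := (integral_eq_zero_iff_of_nonneg (fun x => mul_nonneg (he0 x).le (hnn x)) hgi).1 h.symm
      have h5 : ∫ x : S2, inner ℝ b (x : E3) ∂dω = ‖b‖ := by
        rw [integral_congr_ae (g := fun _ => ‖b‖)]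
        · simp
        · filter_upwards [h4] with x hx
          have := (mul_eq_zero.1 hx).resolve_left (he0 x).ne'
          linarith
      rw [h2] at h5
      exact hbp.ne h5
    simp only [mul_sub] at h3
    rw [integral_sub (hei.mul_const _) (hei.mul_continuous_sphere hbxc), h1,
      integral_mul_const] at h3
    nlinarith
  rw [expDet]
  change 0 < (∫ x, e x ∂dω) ^ 2 - ∑ i, b i ^ 2
  rw [← hnb]
  nlinarith [norm_nonneg b]

/-! ### Exponential moments along a line -/

/-- The weighted exponential moments `∫ φⁿ e^{tφ} w dω`. -/
noncomputable def expMoment (φ : H1) (w : S2 → ℝ) (n : ℕ) (t : ℝ) : ℝ :=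
  ∫ x, φ.val x ^ n * Real.exp (t * φ.val x) * w x ∂dω

theorem H1.integrable_pow_mul_exp (φ : H1) (n : ℕ) (t : ℝ) :
    Integrable (fun x => |φ.val x| ^ n * Real.exp (t * φ.val x)) dω := by
  refine ProbabilityTheory.integrable_pow_abs_mul_exp_of_mem_interior_integrableExpSet ?_ n
  have : ProbabilityTheory.integrableExpSet φ.val dω = Set.univ :=
    Set.eq_univ_of_forall fun c => φ.integrable_exp c
  simp [this]

theorem H1.integrable_expMoment (φ : H1) {w : S2 → ℝ} (hw : Continuous w) (n : ℕ) (t : ℝ) :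
    Integrable (fun x => φ.val x ^ n * Real.exp (t * φ.val x) * w x) dω := by
  refine Integrable.mul_continuous_sphere ?_ hw
  refine (φ.integrable_pow_mul_exp n t).mono'
    ((φ.memLp_val.1.pow n).mul (φ.aestronglyMeasurable_exp t)) (.of_forall fun x => ?_)
  rw [norm_mul, norm_pow, Real.norm_eq_abs, Real.norm_of_nonneg (Real.exp_pos _).le]

theorem hasDerivAt_expMoment (φ : H1) {w : S2 → ℝ} (hw : Continuous w) (n : ℕ) (t : ℝ) :
    HasDerivAt (expMoment φ w n) (expMoment φ w (n + 1) t) t := by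
  obtain ⟨C, hC⟩ := (isCompact_range hw).isBounded.exists_norm_le
  have hC0 (x : S2) : |w x| ≤ C := hC _ ⟨x, rfl⟩
  refine (hasDerivAt_integral_of_dominated_loc_of_deriv_le (ball_mem_nhds t one_pos)
    (F' := fun t x => φ.val x ^ (n + 1) * Real.exp (t * φ.val x) * w x)
    (bound := fun x => C * (|φ.val x| ^ (n + 1) * Real.exp ((t + 1) * φ.val x)
      + |φ.val x| ^ (n + 1) * Real.exp ((t - 1) * φ.val x)))
    (.of_forall fun s => (φ.integrable_expMoment hw n s).1) (φ.integrable_expMoment hw n t)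
    (φ.integrable_expMoment hw (n + 1) t).1 (.of_forall fun x s hs => ?_)
    (((φ.integrable_pow_mul_exp _ _).add (φ.integrable_pow_mul_exp _ _)).const_mul C)
    (.of_forall fun x s _ => ?_)).2
  · rw [mem_ball, Real.dist_eq, abs_lt] at hs
    have h1 : Real.exp (s * φ.val x)
        ≤ Real.exp ((t + 1) * φ.val x) + Real.exp ((t - 1) * φ.val x) := by
      rcases le_total 0 (φ.val x) with h | h
      · have : Real.exp (s * φ.val x) ≤ Real.exp ((t + 1) * φ.val x) :=
          Real.exp_le_exp.2 (mul_le_mul_of_nonneg_right (by linarith) h)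
        linarith [Real.exp_pos ((t - 1) * φ.val x)]
      · have : Real.exp (s * φ.val x) ≤ Real.exp ((t - 1) * φ.val x) :=
          Real.exp_le_exp.2 (mul_le_mul_of_nonpos_right (by linarith) h)
        linarith [Real.exp_pos ((t + 1) * φ.val x)]
    rw [norm_mul, norm_mul, norm_pow, Real.norm_eq_abs, Real.norm_of_nonneg (Real.exp_pos _).le,
      Real.norm_eq_abs, ← mul_add, mul_comm C]
    gcongr
    exact hC0 x
  · have h := (((hasDerivAt_id s).mul_const (φ.val x)).exp.const_mul (φ.val x ^ n)).mul_const (w x)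
    refine h.congr_deriv ?_
    simp only [id]
    ring

theorem contDiff_expMoment (φ : H1) {w : S2 → ℝ} (hw : Continuous w) (k n : ℕ) :
    ContDiff ℝ k (expMoment φ w n) := by
  induction k generalizing n with
  | zero =>
    exact contDiff_zero.2 (continuous_iff_continuousAt.2 fun t =>
      (hasDerivAt_expMoment φ hw n t).continuousAt)
  | succ k ih =>
    push_cast
    rw [contDiff_succ_iff_deriv]
    refine ⟨fun t => (hasDerivAt_expMoment φ hw n t).differentiableAt, by simp, ?_⟩
    rw [funext fun t => (hasDerivAt_expMoment φ hw n t).deriv]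
    exact ih (n + 1)

theorem H1.val_smul (t : ℝ) (φ : H1) : (0 + t • φ).val =ᵐ[dω] fun x => t * φ.val x := by
  rw [zero_add]
  exact Lp.coeFn_smul t φ.1.1

theorem H1.grad_smul (t : ℝ) (φ : H1) : (0 + t • φ).grad =ᵐ[dω] fun x => t • φ.grad x := by
  rw [zero_add]
  exact Lp.coeFn_smul t φ.1.2

theorem integral_exp_smul (φ : H1) (w : S2 → ℝ) (t : ℝ) :
    ∫ x, Real.exp (2 * (0 + t • φ).val x) * w x ∂dω = expMoment φ w 0 (2 * t) := by
  refine integral_congr_ae ?_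
  filter_upwards [φ.val_smul t] with x hx
  rw [hx, pow_zero, one_mul, mul_assoc]

theorem expDet_smul (φ : H1) (t : ℝ) : expDet (0 + t • φ)
    = expMoment φ (fun _ => 1) 0 (2 * t) ^ 2
      - ∑ i : Fin 3, expMoment φ (fun x => (x : E3) i) 0 (2 * t) ^ 2 := by
  rw [expDet]
  simp only [← integral_exp_smul, mul_one]

theorem functionalI_smul (α : ℝ) (φ : H1) (t : ℝ) : functionalI α (0 + t • φ)
    = α * ‖φ.1.2‖ ^ 2 * t ^ 2 + 2 * (∫ x, φ.val x ∂dω) * t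
      - 1 / 2 * Real.log (expDet (0 + t • φ)) := by
  have h1 : ∫ x, ‖(0 + t • φ).grad x‖ ^ 2 ∂dω = ‖φ.1.2‖ ^ 2 * t ^ 2 := by
    rw [norm_sq_eq_integral, ← integral_mul_const]
    refine integral_congr_ae ?_
    filter_upwards [φ.grad_smul t] with x hx
    rw [hx, norm_smul, mul_pow, Real.norm_eq_abs, sq_abs, mul_comm]
    rfl
  have h2 : ∫ x, (0 + t • φ).val x ∂dω = (∫ x, φ.val x ∂dω) * t := by
    rw [← integral_mul_const]
    refine integral_congr_ae ?_
    filter_upwards [φ.val_smul t] with x hx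
    rw [hx, mul_comm]
  rw [functionalI, h1, h2]
  ring

/-! ### The second variation -/

theorem hasDerivAt_expMoment_two_mul (φ : H1) {w : S2 → ℝ} (hw : Continuous w) (n : ℕ) (t : ℝ) :
    HasDerivAt (fun t => expMoment φ w n (2 * t)) (2 * expMoment φ w (n + 1) (2 * t)) t := by
  have h := (hasDerivAt_expMoment φ hw n (2 * t)).comp t ((hasDerivAt_id t).const_mul 2)
  refine h.congr_deriv ?_
  simp [mul_comm]

theorem expMoment_at_zero (φ : H1) (w : S2 → ℝ) (n : ℕ) :
    expMoment φ w n 0 = ∫ x, φ.val x ^ n * w x ∂dω := by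
  simp [expMoment]

/-- The first derivative of `t ↦ expDet (t φ)`. -/
noncomputable def expDetDeriv (φ : H1) (t : ℝ) : ℝ :=
  4 * (expMoment φ (fun _ => 1) 0 (2 * t) * expMoment φ (fun _ => 1) 1 (2 * t))
    - ∑ i : Fin 3, 4 * (expMoment φ (fun x => (x : E3) i) 0 (2 * t)
      * expMoment φ (fun x => (x : E3) i) 1 (2 * t))

theorem hasDerivAt_expDet (φ : H1) (t : ℝ) :
    HasDerivAt (fun t : ℝ => expDet (0 + t • φ)) (expDetDeriv φ t) t := by
  simp only [expDet_smul]
  have h1 := (hasDerivAt_expMoment_two_mul φ (w := fun _ => 1) continuous_const 0 t).pow 2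
  have h2 := HasDerivAt.fun_sum (u := Finset.univ) fun (i : Fin 3) _ =>
    (hasDerivAt_expMoment_two_mul φ (continuous_coord i) 0 t).pow 2
  refine (h1.sub h2).congr_deriv ?_
  rw [expDetDeriv]
  congr 1
  · push_cast; ring
  · exact Finset.sum_congr rfl fun i _ => by push_cast; ring

theorem hasDerivAt_expDetDeriv_zero (φ : H1) :
    HasDerivAt (expDetDeriv φ)
      (8 * ((∫ x, φ.val x ∂dω) ^ 2 + ∫ x, φ.val x ^ 2 ∂dω)
        - ∑ i : Fin 3, 8 * (∫ x, φ.val x * (x : E3) i ∂dω) ^ 2) 0 := by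
  have h1 := ((hasDerivAt_expMoment_two_mul φ (w := fun _ => 1) continuous_const 0 0).mul
    (hasDerivAt_expMoment_two_mul φ (w := fun _ => 1) continuous_const 1 0)).const_mul 4
  have h2 := HasDerivAt.fun_sum (u := Finset.univ) fun (i : Fin 3) _ =>
    ((hasDerivAt_expMoment_two_mul φ (continuous_coord i) 0 0).mul
      (hasDerivAt_expMoment_two_mul φ (continuous_coord i) 1 0)).const_mul 4
  refine (h1.sub h2).congr_deriv ?_
  simp only [mul_zero, expMoment_at_zero, pow_zero, one_mul, mul_one, zero_add, pow_one, integral_coord]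
  congr 1
  · simp; ring
  · exact Finset.sum_congr rfl fun i _ => by ring

theorem contDiff_functionalI (α : ℝ) (φ : H1) :
    ContDiff ℝ 2 fun t : ℝ => functionalI α (0 + t • φ) := by
  simp only [functionalI_smul]
  have h2 : ContDiff ℝ 2 fun t : ℝ => 2 * t := by fun_prop
  have h1 {w : S2 → ℝ} (hw : Continuous w) : ContDiff ℝ 2 fun t => expMoment φ w 0 (2 * t) :=
    (contDiff_expMoment φ hw 2 0).comp h2
  have hD : ContDiff ℝ 2 fun t : ℝ => expDet (0 + t • φ) := by
    simp only [expDet_smul]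
    exact ((h1 continuous_const).pow 2).sub
      (ContDiff.sum fun i _ => (h1 (continuous_coord i)).pow 2)
  have hlog : ContDiff ℝ 2 fun t : ℝ => Real.log (expDet (0 + t • φ)) :=
    hD.log fun t => (expDet_pos _).ne'
  fun_prop

theorem hasDerivAt_functionalI (α : ℝ) (φ : H1) (t : ℝ) :
    HasDerivAt (fun t : ℝ => functionalI α (0 + t • φ))
      (2 * α * ‖φ.1.2‖ ^ 2 * t + 2 * (∫ x, φ.val x ∂dω)
        - 1 / 2 * (expDetDeriv φ t / expDet (0 + t • φ))) t := by
  simp only [functionalI_smul]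
  have h1 := ((hasDerivAt_id t).pow 2).const_mul (α * ‖φ.1.2‖ ^ 2)
  have h2 := (hasDerivAt_id t).const_mul (2 * (∫ x, φ.val x ∂dω))
  have h3 := ((hasDerivAt_expDet φ t).log (expDet_pos _).ne').const_mul (1 / 2)
  refine ((h1.add h2).sub h3).congr_deriv ?_
  simp
  ring

theorem expDet_zero (φ : H1) : expDet (0 + (0 : ℝ) • φ) = 1 := by
  rw [expDet_smul]
  simp [expMoment_at_zero, integral_coord]

theorem expDetDeriv_zero (φ : H1) : expDetDeriv φ 0 = 4 * ∫ x, φ.val x ∂dω := by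
  rw [expDetDeriv]
  simp [expMoment_at_zero, integral_coord]

theorem deriv_functionalI_zero (α : ℝ) (φ : H1) :
    deriv (fun t : ℝ => functionalI α (0 + t • φ)) 0 = 0 := by
  rw [(hasDerivAt_functionalI α φ 0).deriv, expDet_zero, expDetDeriv_zero]
  ring

theorem functionalI_zero (α : ℝ) (φ : H1) : functionalI α (0 + (0 : ℝ) • φ) = 0 := by
  rw [functionalI_smul, expDet_zero]
  simp

/-- The second variation of `I_α` at `0`. -/
theorem secondVariation_eq (α : ℝ) (φ : H1) : secondVariation (functionalI α) 0 φ
    = 2 * α * ‖φ.1.2‖ ^ 2 - 4 * ((∫ x, φ.val x ^ 2 ∂dω) - (∫ x, φ.val x ∂dω) ^ 2)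
      + 4 * ∑ i : Fin 3, (∫ x, φ.val x * (x : E3) i ∂dω) ^ 2 := by
  rw [secondVariation, iteratedDeriv_succ, iteratedDeriv_one,
    funext fun t => (hasDerivAt_functionalI α φ t).deriv]
  have h1 := (hasDerivAt_id (0 : ℝ)).const_mul (2 * α * ‖φ.1.2‖ ^ 2)
  have h2 := ((hasDerivAt_expDetDeriv_zero φ).div (hasDerivAt_expDet φ 0)
    (expDet_pos _).ne').const_mul (1 / 2)
  have h3 := (h1.add_const (2 * (∫ x, φ.val x ∂dω))).sub h2
  refine h3.deriv.trans ?_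
  rw [expDet_zero, expDetDeriv_zero, ← Finset.mul_sum]
  ring

/-! ### Splitting off the affine part -/

/-- The affine polynomial with constant term `a` and linear coefficients `b`. -/
noncomputable def affinePoly (a : ℝ) (b : Fin 3 → ℝ) : MvPolynomial (Fin 3) ℝ :=
  .C a + ∑ i, .C (b i) * .X i

theorem polyFun_affinePoly (a : ℝ) (b : Fin 3 → ℝ) (x : E3) :
    polyFun (affinePoly a b) x = a + ∑ i, b i * x i := by
  simp [affinePoly]

theorem totalDegree_affinePoly_le (a : ℝ) (b : Fin 3 → ℝ) : (affinePoly a b).totalDegree ≤ 1 := by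
  refine (MvPolynomial.totalDegree_add _ _).trans (max_le (by simp) ?_)
  refine MvPolynomial.totalDegree_finsetSum_le fun i _ => ?_
  exact (MvPolynomial.totalDegree_mul _ _).trans (by simp)

theorem sphLap_affinePoly (a : ℝ) (b : Fin 3 → ℝ) :
    sphLap (affinePoly a b) = affinePoly 0 fun i => 2 * b i := by
  have h0 : sphLap (.C a) = 0 := by
    rw [sphLap_of_isHomogeneous (MvPolynomial.isHomogeneous_C _ _)]
    simp
  have h1 (i : Fin 3) : sphLap (.C (b i) * .X i) = .C (2 * b i) * .X i := by
    rw [sphLap_of_isHomogeneous (MvPolynomial.isHomogeneous_C_mul_X _ _)]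
    have h2 (j : Fin 3) : MvPolynomial.pderiv j (MvPolynomial.pderiv j
        (.C (b i) * .X i : MvPolynomial (Fin 3) ℝ)) = 0 := by
      rw [MvPolynomial.pderiv_C_mul, MvPolynomial.pderiv_X, Pi.single_apply]
      split_ifs <;> simp
    simp only [h2, Finset.sum_const_zero, mul_zero, sub_zero, MvPolynomial.smul_eq_C_mul,
      ← mul_assoc, ← map_mul]
    norm_num
  rw [affinePoly, map_add, map_sum, h0]
  simp [affinePoly, h1]

/-- A function is orthogonal to the polynomials of degree at most one as soon as it is orthogonal
to `1, x₁, x₂, x₃`. -/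
theorem mem_orthogonal_polySpace_one {u : Lp ℝ 2 dω} (h1 : inner ℝ (polyLp 1) u = 0)
    (hX : ∀ i, inner ℝ (polyLp (.X i)) u = 0) : u ∈ (polySpace 1)ᗮ := by
  rintro _ ⟨q, hq, rfl⟩
  have hq : q.totalDegree ≤ 1 := (MvPolynomial.mem_restrictTotalDegree _ _ _).1 hq
  have hC {r : MvPolynomial (Fin 3) ℝ} (hr : r.IsHomogeneous 0) : ∃ a, r = .C a := by
    rw [← MvPolynomial.totalDegree_zero_iff_isHomogeneous,
      MvPolynomial.totalDegree_eq_zero_iff_eq_C] at hr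
    exact ⟨_, hr⟩
  have hmem : q ∈ LinearMap.ker ((innerSL ℝ u : Lp ℝ 2 dω →ₗ[ℝ] ℝ) ∘ₗ polyLp) := by
    refine totalDegree_le_induction (N := 1) (fun n hn r hr => ?_) hq
    have key : inner ℝ u (polyLp r) = 0 := by
      interval_cases n
      · obtain ⟨a, rfl⟩ := hC hr
        rw [show (MvPolynomial.C a : MvPolynomial (Fin 3) ℝ) = a • 1 by
          rw [MvPolynomial.smul_eq_C_mul, mul_one], map_smul, inner_smul_right, real_inner_comm, h1,
          mul_zero]
      · have he := hr.sum_X_mul_pderiv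
        rw [one_smul] at he
        rw [← he, map_sum, inner_sum]
        refine Finset.sum_eq_zero fun i _ => ?_
        obtain ⟨a, ha⟩ := hC (hr.pderiv (i := i))
        rw [ha, mul_comm, ← MvPolynomial.smul_eq_C_mul, map_smul, inner_smul_right,
          real_inner_comm, hX, mul_zero]
    simpa using key
  rw [real_inner_comm]
  simpa using hmem

/-- The first-order Fourier coefficient `∫ φ xᵢ dω`. -/
noncomputable def H1.coeff (φ : H1) (i : Fin 3) : ℝ := ∫ x, φ.val x * (x : E3) i ∂dω

/-- The mean value `∫ φ dω`. -/
noncomputable def H1.mean (φ : H1) : ℝ := ∫ x, φ.val x ∂dω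

/-- The orthogonal projection of `φ` to the span of `1, x₁, x₂, x₃`; the factor `3` comes from
`∫ xᵢ² dω = 1 / 3`. -/
noncomputable def H1.affinePart (φ : H1) : MvPolynomial (Fin 3) ℝ :=
  affinePoly φ.mean fun i => 3 * φ.coeff i

/-- The part of `φ` orthogonal to `1, x₁, x₂, x₃`. -/
noncomputable def H1.remainder (φ : H1) : H1 := φ - polyH1 φ.affinePart

theorem H1.remainder_fst (φ : H1) : φ.remainder.1.1 = φ.1.1 - polyLp φ.affinePart := by
  rw [← polyH1_fst]
  rfl

theorem H1.remainder_snd (φ : H1) : φ.remainder.1.2 = φ.1.2 - (polyH1 φ.affinePart).1.2 := rfl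

theorem H1.inner_one (φ : H1) : inner ℝ (polyLp 1) φ.1.1 = φ.mean := by
  rw [inner_polyLp]
  simp [H1.mean, H1.val]

theorem H1.inner_X (φ : H1) (i : Fin 3) : inner ℝ (polyLp (.X i)) φ.1.1 = φ.coeff i := by
  rw [inner_polyLp]
  simp [H1.coeff, H1.val, mul_comm]

theorem H1.inner_affinePoly (φ : H1) (a : ℝ) (b : Fin 3 → ℝ) :
    inner ℝ (polyLp (affinePoly a b)) φ.1.1 = a * φ.mean + ∑ i, b i * φ.coeff i := by
  have h : affinePoly a b = a • 1 + ∑ i, b i • .X i := by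
    simp [affinePoly, MvPolynomial.smul_eq_C_mul]
  rw [h, map_add, map_sum, inner_add_left, sum_inner]
  simp [inner_smul_left, H1.inner_one, H1.inner_X]

theorem mean_affine (a : ℝ) (b : Fin 3 → ℝ) : ∫ x : S2, (a + ∑ i, b i * (x : E3) i) ∂dω = a := by
  have hi (i : Fin 3) : Integrable (fun x : S2 => b i * (x : E3) i) dω :=
    (continuous_coord i).integrable_sphere.const_mul _
  rw [integral_add (integrable_const a) (integrable_finsetSum _ fun i _ => hi i),
    integral_finsetSum _ fun i _ => hi i]
  simp [integral_const_mul, integral_coord]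

theorem coeff_affine (a : ℝ) (b : Fin 3 → ℝ) (j : Fin 3) :
    ∫ x : S2, (a + ∑ i, b i * (x : E3) i) * (x : E3) j ∂dω = b j / 3 := by
  have hi (i : Fin 3) : Integrable (fun x : S2 => b i * ((x : E3) i * (x : E3) j)) dω :=
    Integrable.const_mul (Continuous.integrable_sphere
      ((continuous_coord i).mul (continuous_coord j))) _
  simp only [add_mul, Finset.sum_mul, mul_assoc]
  rw [integral_add ((continuous_coord j).integrable_sphere.const_mul _)
    (integrable_finsetSum _ fun i _ => hi i), integral_finsetSum _ fun i _ => hi i]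
  simp [integral_const_mul, integral_coord, integral_coord_mul]
  ring

theorem H1.mean_of_affine {φ : H1} {a : ℝ} {b : Fin 3 → ℝ}
    (h : φ.val =ᵐ[dω] fun x => a + ∑ i, b i * (x : E3) i) : φ.mean = a := by
  rw [H1.mean, integral_congr_ae h, mean_affine]

theorem H1.coeff_of_affine {φ : H1} {a : ℝ} {b : Fin 3 → ℝ}
    (h : φ.val =ᵐ[dω] fun x => a + ∑ i, b i * (x : E3) i) (j : Fin 3) : φ.coeff j = b j / 3 := by
  rw [← coeff_affine a b j]
  refine integral_congr_ae ?_
  filter_upwards [h] with x hx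
  rw [hx]

theorem val_polyH1_affinePoly (a : ℝ) (b : Fin 3 → ℝ) :
    (polyH1 (affinePoly a b)).val =ᵐ[dω] fun x => a + ∑ i, b i * (x : E3) i := by
  filter_upwards [H1.val_ofSmooth (contDiff_polyFun (affinePoly a b))] with x hx
  rw [← polyFun_affinePoly, ← hx]
  rfl

theorem H1.remainder_mem_orthogonal (φ : H1) : φ.remainder.1.1 ∈ (polySpace 1)ᗮ := by
  have h := val_polyH1_affinePoly φ.mean fun i => 3 * φ.coeff i
  refine mem_orthogonal_polySpace_one ?_ fun i => ?_
  · rw [H1.remainder_fst, inner_sub_right, φ.inner_one, ← polyH1_fst φ.affinePart, H1.inner_one,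
      H1.affinePart, H1.mean_of_affine h, sub_self]
  · rw [H1.remainder_fst, inner_sub_right, φ.inner_X, ← polyH1_fst φ.affinePart, H1.inner_X,
      H1.affinePart, H1.coeff_of_affine h]
    ring

theorem H1.inner_affine_remainder (φ : H1) {q : MvPolynomial (Fin 3) ℝ} (hq : q.totalDegree ≤ 1) :
    inner ℝ (polyLp q) φ.remainder.1.1 = 0 :=
  φ.remainder_mem_orthogonal _ (polyLp_mem_polySpace hq)

theorem H1.norm_sq_val (φ : H1) :
    ‖φ.1.1‖ ^ 2 = ‖φ.remainder.1.1‖ ^ 2 + φ.mean ^ 2 + 3 * ∑ i, φ.coeff i ^ 2 := by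
  have h0 := φ.inner_affine_remainder (totalDegree_affinePoly_le φ.mean fun i => 3 * φ.coeff i)
  change inner ℝ (polyLp φ.affinePart) _ = 0 at h0
  have h1 := φ.inner_affinePoly φ.mean fun i => 3 * φ.coeff i
  change inner ℝ (polyLp φ.affinePart) _ = _ at h1
  have h2 : φ.1.1 = polyLp φ.affinePart + φ.remainder.1.1 := by rw [H1.remainder_fst]; abel
  have h3 := h1
  rw [h2, inner_add_right, h0, add_zero, real_inner_self_eq_norm_sq] at h3
  rw [h2, norm_add_sq_real, h0, h3, Finset.mul_sum]
  simp only [mul_assoc, ← sq]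
  ring

theorem H1.norm_sq_grad (φ : H1) :
    ‖φ.1.2‖ ^ 2 = ‖φ.remainder.1.2‖ ^ 2 + 6 * ∑ i, φ.coeff i ^ 2 := by
  set a := polyH1 φ.affinePart with ha
  have h0 : inner ℝ φ.remainder.1.2 a.1.2 = 0 := by
    rw [ha, H1.inner_grad_polyH1, real_inner_comm, H1.affinePart, sphLap_affinePoly]
    exact φ.inner_affine_remainder (totalDegree_affinePoly_le _ _)
  have h1 : inner ℝ φ.1.2 a.1.2 = 6 * ∑ i, φ.coeff i ^ 2 := by
    rw [ha, H1.inner_grad_polyH1, real_inner_comm, H1.affinePart, sphLap_affinePoly,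
      H1.inner_affinePoly, zero_mul, zero_add, Finset.mul_sum]
    exact Finset.sum_congr rfl fun i _ => by ring
  have h2 : φ.1.2 = φ.remainder.1.2 + a.1.2 := by rw [H1.remainder_snd]; abel
  have h3 := h1
  rw [h2, inner_add_left, h0, zero_add, real_inner_self_eq_norm_sq] at h3
  rw [h2, norm_add_sq_real, h0, h3]
  ring

/-- The second variation is diagonal with respect to the splitting of `φ` into its affine part and
its remainder. -/
theorem secondVariation_eq_remainder (α : ℝ) (φ : H1) : secondVariation (functionalI α) 0 φ
    = 2 * α * ‖φ.remainder.1.2‖ ^ 2 - 4 * ‖φ.remainder.1.1‖ ^ 2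
      + (12 * α - 8) * ∑ i, φ.coeff i ^ 2 := by
  have h1 : ∫ x, φ.val x ^ 2 ∂dω = ‖φ.1.1‖ ^ 2 := by
    rw [norm_sq_eq_integral]
    simp only [Real.norm_eq_abs, sq_abs]
    rfl
  have h2 : ∑ i : Fin 3, (∫ x, φ.val x * (x : E3) i ∂dω) ^ 2 = ∑ i, φ.coeff i ^ 2 := rfl
  have h3 : ∫ x, φ.val x ∂dω = φ.mean := rfl
  rw [secondVariation_eq, h1, h2, h3, φ.norm_sq_val, φ.norm_sq_grad]
  ring

/-- The spectral gap bounds the form from below: the coefficient of `‖ψ‖²` is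
`12 α - 4 ≥ 4`. -/
theorem le_secondVariation {α : ℝ} (hα : 2 / 3 ≤ α) (φ : H1) :
    4 * ‖φ.remainder.1.1‖ ^ 2 + (12 * α - 8) * ∑ i, φ.coeff i ^ 2
      ≤ secondVariation (functionalI α) 0 φ := by
  have h := φ.remainder.spectral_gap φ.remainder_mem_orthogonal
  rw [secondVariation_eq_remainder]
  nlinarith [mul_le_mul_of_nonneg_left h (by linarith : 0 ≤ 2 * α), sq_nonneg ‖φ.remainder.1.1‖,
    mul_nonneg (by linarith : 0 ≤ α - 2 / 3) (sq_nonneg ‖φ.remainder.1.1‖)]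

theorem secondVariation_nonneg {α : ℝ} (hα : 2 / 3 ≤ α) (φ : H1) :
    0 ≤ secondVariation (functionalI α) 0 φ := by
  refine le_trans ?_ (le_secondVariation hα φ)
  have h1 : 0 ≤ ∑ i, φ.coeff i ^ 2 := Finset.sum_nonneg fun i _ => sq_nonneg _
  have h2 : 0 ≤ 12 * α - 8 := by linarith
  positivity

theorem H1.val_of_remainder_eq_zero {φ : H1} (h : φ.remainder.1.1 = 0) :
    φ.val =ᵐ[dω] fun x => φ.mean + ∑ i, 3 * φ.coeff i * (x : E3) i := by
  rw [H1.remainder_fst, sub_eq_zero] at h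
  filter_upwards [coeFn_polyLp φ.affinePart] with x hx
  rw [← polyFun_affinePoly φ.mean fun i => 3 * φ.coeff i]
  rw [H1.val, h, hx, H1.affinePart]

theorem H1.remainder_of_affine {φ : H1} {a : ℝ} {b : Fin 3 → ℝ}
    (h : φ.val =ᵐ[dω] fun x => a + ∑ i, b i * (x : E3) i) : φ.remainder = 0 := by
  have h1 : φ.1.1 = polyLp (affinePoly a b) := by
    refine Lp.ext ?_
    filter_upwards [h, coeFn_polyLp (affinePoly a b)] with x h1 h2
    rw [h2, polyFun_affinePoly, ← h1]
    rfl
  have h2 : φ.remainder.1.1 = polyLp (affinePoly a b - φ.affinePart) := by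
    rw [H1.remainder_fst, h1, map_sub]
  have h3 : inner ℝ φ.remainder.1.1 φ.remainder.1.1 = 0 := by
    nth_rw 1 [h2]
    exact φ.inner_affine_remainder ((MvPolynomial.totalDegree_sub _ _).trans
      (max_le (totalDegree_affinePoly_le _ _) (totalDegree_affinePoly_le _ _)))
  exact H1.eq_zero_of_val (Lp.eq_zero_iff_ae_eq_zero.1 (inner_self_eq_zero.1 h3))

theorem secondVariation_of_affine (α : ℝ) {φ : H1} {a : ℝ} {b : Fin 3 → ℝ}
    (h : φ.val =ᵐ[dω] fun x => a + ∑ i, b i * (x : E3) i) :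
    secondVariation (functionalI α) 0 φ = (12 * α - 8) * ∑ i, (b i / 3) ^ 2 := by
  rw [secondVariation_eq_remainder, H1.remainder_of_affine h]
  simp [H1.coeff_of_affine h]

theorem secondVariation_eq_zero_iff {α : ℝ} (hα : 2 / 3 < α) (φ : H1) :
    secondVariation (functionalI α) 0 φ = 0 ↔ ∃ c : ℝ, φ.val =ᵐ[dω] fun _ => c := by
  constructor
  · intro h
    have h1 := le_secondVariation hα.le φ
    have h2 : 0 ≤ ∑ i, φ.coeff i ^ 2 := Finset.sum_nonneg fun i _ => sq_nonneg _
    have h3 := mul_nonneg (by linarith : 0 ≤ 12 * α - 8) h2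
    have h4 : ‖φ.remainder.1.1‖ ^ 2 = 0 := by nlinarith [sq_nonneg ‖φ.remainder.1.1‖]
    have h5 : ∑ i, φ.coeff i ^ 2 = 0 := by
      have h6 : (12 * α - 8) * ∑ i, φ.coeff i ^ 2 = 0 := by nlinarith
      exact (mul_eq_zero.1 h6).resolve_left (by linarith)
    have h7 (i : Fin 3) : φ.coeff i = 0 :=
      pow_eq_zero_iff two_ne_zero |>.1
        ((Finset.sum_eq_zero_iff_of_nonneg fun i _ => sq_nonneg _).1 h5 i (Finset.mem_univ i))
    refine ⟨φ.mean, ?_⟩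
    filter_upwards [H1.val_of_remainder_eq_zero (norm_eq_zero.1 (pow_eq_zero_iff two_ne_zero |>.1 h4))]
      with x hx
    simpa [h7] using hx
  · rintro ⟨c, hc⟩
    rw [secondVariation_of_affine α (a := c) (b := 0) (by simpa using hc)]
    simp

theorem secondVariation_two_thirds_eq_zero_iff (φ : H1) :
    secondVariation (functionalI (2 / 3)) 0 φ = 0 ↔
      ∃ (c : ℝ) (b : Fin 3 → ℝ), φ.val =ᵐ[dω] fun x => c + ∑ i : Fin 3, b i * (x : E3) i := by
  constructor
  · intro h
    have h1 := le_secondVariation le_rfl φ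
    have h4 : ‖φ.remainder.1.1‖ ^ 2 = 0 := by nlinarith [sq_nonneg ‖φ.remainder.1.1‖]
    exact ⟨_, _, H1.val_of_remainder_eq_zero (norm_eq_zero.1 (pow_eq_zero_iff two_ne_zero |>.1 h4))⟩
  · rintro ⟨c, b, h⟩
    rw [secondVariation_of_affine _ h]
    norm_num

theorem secondVariation_pos {α : ℝ} (hα : 2 / 3 < α) {φ : H1} (h0 : φ ≠ 0)
    (h : ∀ c : ℝ, φ.val =ᵐ[dω] (fun _ => c) → c = 0) :
    0 < secondVariation (functionalI α) 0 φ := by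
  refine lt_of_le_of_ne (secondVariation_nonneg hα.le φ) fun he => h0 ?_
  obtain ⟨c, hc⟩ := (secondVariation_eq_zero_iff hα φ).1 he.symm
  rw [h c hc] at hc
  exact H1.eq_zero_of_val hc

theorem secondVariation_X_neg {α : ℝ} (hα : α < 2 / 3) :
    secondVariation (functionalI α) 0 (polyH1 (affinePoly 0 (Pi.single 0 1))) < 0 := by
  rw [secondVariation_of_affine α (val_polyH1_affinePoly _ _)]
  simp [Fin.sum_univ_three]
  linarith

open Filter Topology in
/-- Where the second variation is negative, `I_α` takes values below `I_α(0) = 0`: otherwise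
`t ↦ I_α(t φ)` would have both a minimum and a local maximum at `0`, hence be constant near `0`. -/
theorem exists_functionalI_neg {α : ℝ} {φ : H1} (h : secondVariation (functionalI α) 0 φ < 0) :
    ∃ u : H1, functionalI α u < 0 := by
  by_contra! hn
  set g : ℝ → ℝ := fun t => functionalI α (0 + t • φ) with hg
  have h2 : deriv (deriv g) 0 < 0 := by
    rwa [secondVariation, iteratedDeriv_succ, iteratedDeriv_one] at h
  have hmax := isLocalMax_of_deriv_deriv_neg h2 (deriv_functionalI_zero α φ)
    (contDiff_functionalI α φ).continuous.continuousAt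
  have h0 : g =ᶠ[𝓝 0] fun _ => 0 := by
    filter_upwards [hmax] with t ht
    exact le_antisymm (ht.trans_eq (functionalI_zero α φ)) (hn _)
  have h1 : deriv (deriv g) 0 = 0 := by
    rw [h0.deriv.deriv_eq]
    simp
  exact h2.ne h1

theorem mainTheorem9 :
    -- `I_α` is well defined on `H¹(𝕊²)` and has a second variation at `0`
    (∀ u : H1, Integrable (fun x => Real.exp (2 * u.val x)) dω ∧ 0 < expDet u) ∧
    (∀ (α : ℝ) (φ : H1), ContDiffAt ℝ 2 (fun t : ℝ => functionalI α (0 + t • φ)) 0) ∧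
    -- the case `2/3 < α < 1`
    (∀ α : ℝ, 2 / 3 < α → α < 1 →
      (∀ φ : H1, 0 ≤ secondVariation (functionalI α) 0 φ) ∧
      (∀ φ : H1, secondVariation (functionalI α) 0 φ = 0 ↔
        ∃ c : ℝ, φ.val =ᵐ[dω] fun _ => c) ∧
      (∀ φ : H1, φ ∈ normalizedClass → φ ≠ 0 → 0 < secondVariation (functionalI α) 0 φ) ∧
      (∀ φ : H1, ∫ x, φ.val x ∂dω = 0 → φ ≠ 0 → 0 < secondVariation (functionalI α) 0 φ)) ∧
    -- the case `α = 2/3`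
    ((∀ φ : H1, 0 ≤ secondVariation (functionalI (2 / 3)) 0 φ) ∧
      (∀ φ : H1, secondVariation (functionalI (2 / 3)) 0 φ = 0 ↔
        ∃ (c : ℝ) (b : Fin 3 → ℝ), φ.val =ᵐ[dω] fun x => c + ∑ i : Fin 3, b i * (x : E3) i)) ∧
    -- the case `α < 2/3`
    (∀ α : ℝ, α < 2 / 3 →
      (¬ ∀ φ : H1, 0 ≤ secondVariation (functionalI α) 0 φ) ∧
      (∃ u : H1, functionalI α u < 0)) := by
  refine ⟨fun u => ⟨u.integrable_exp 2, expDet_pos u⟩,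
    fun α φ => (contDiff_functionalI α φ).contDiffAt, fun α h1 _ => ⟨secondVariation_nonneg h1.le,
      secondVariation_eq_zero_iff h1, fun φ hφ h0 => secondVariation_pos h1 h0 fun c hc => ?_,
      fun φ hφ h0 => secondVariation_pos h1 h0 fun c hc => ?_⟩,
    ⟨secondVariation_nonneg le_rfl, secondVariation_two_thirds_eq_zero_iff⟩,
    fun α hα => ⟨fun h => (h _).not_gt (secondVariation_X_neg hα),
      exists_functionalI_neg (secondVariation_X_neg hα)⟩⟩
  · have h := hφ.2
    rw [integral_congr_ae (g := fun _ => Real.exp (2 * c)) (by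
      filter_upwards [hc] with x hx
      rw [hx])] at h
    simpa using h
  · rw [integral_congr_ae hc] at hφ
    simpa using hφ
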